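/- Let $X$ be a finite alphabet. A directed labeled graph over $X$ is a directed graph (loops and multiple edges allowed) each of whose edges carries a label in $X$. It is folded if, for every vertex $v$ and every $x\in X$, at most one edge labeled $x$ starts at $v$ and at most one edge labeled $x$ terminates at $v$. An elementary folding is the quotient map that identifies two distinct edges with the same label which both start at, or both terminate at, a common vertex $v$, together with their other endpoints (and identifies nothing else). To fold a graph $\Delta$ means to compute a folded graph $\Gamma$ which is obtained from $\Delta$ by a finite, possibly empty, sequence of elementary foldings, together with the resulting quotient map from the vertices of $\Delta$ to those of $\Gamma$. Let $\log^*(n)$ be the least natural number $k$ such that the $k$-fold iterate of the base $2$ logarithm, applied to $n$, is at most $1$ (so $\log^*(0)=\log^*(1)=0$). Running times are counted on a machine whose objects are named by natural numbers, and whose memory consists of finitely many variables and finitely many unary functions (pointer fields) on objects; assigning a variable a constant or the value of another variable, increasing it by one, evaluating a function or changing its value at one object, and comparing two variables each take one unit of time. A graph is given by its numbers of vertices and edges and the functions assigning to each edge its initial vertex, its terminal vertex and its label, and the folded graph is delivered in the same form. Theorem. For every finite alphabet $X$ there is an algorithm which folds any finite connected (in particular nonempty) directed labeled graph $\Delta$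 over $X$ in time $O(E+(V+E)\log^*(V))$, where $V$ and $E$ are the numbers of vertices and edges of $\Delta$: there is a constant $C$, depending only on $X$, such that the running time is at most $C\cdot\max\{1,\;E+(V+E)\log^*(V)\}$. (The maximum matters only for the graph with one vertex and no edge.) -/

import Mathlib

namespace Stallings

/-! ### Directed labeled graphs, folded graphs, foldings -/

/-- A directed graph (loops and multiple edges allowed) with edges labeled by elements of `X`. -/
structure LGraph (X : Type) where
  Vert : Type
  Edge : Type
  ini : Edge → Vert
  ter : Edge → Vert
  lab : Edge → X

/-- Connected: nonempty, and any two vertices are joined by an undirected edge path. -/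
def LGraph.Connected {X : Type} (G : LGraph X) : Prop :=
  Nonempty G.Vert ∧
    ∀ u v : G.Vert, Relation.EqvGen (fun a b => ∃ e : G.Edge, G.ini e = a ∧ G.ter e = b) u v

/-- Folded: at each vertex there is, for every label, at most one edge with that label starting
there, and at most one edge with that label terminating there. -/
def LGraph.Folded {X : Type} (G : LGraph X) : Prop :=
  (∀ e e' : G.Edge, G.lab e = G.lab e' → G.ini e = G.ini e' → e = e') ∧
    (∀ e e' : G.Edge, G.lab e = G.lab e' → G.ter e = G.ter e' → e = e')

/-- Maps of directed labeled graphs. -/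
structure LGraph.Hom {X : Type} (G H : LGraph X) where
  vert : G.Vert → H.Vert
  edge : G.Edge → H.Edge
  ini_edge : ∀ e, H.ini (edge e) = vert (G.ini e)
  ter_edge : ∀ e, H.ter (edge e) = vert (G.ter e)
  lab_edge : ∀ e, H.lab (edge e) = G.lab e

/-- The identity map. -/
def LGraph.Hom.id {X : Type} (G : LGraph X) : G.Hom G where
  vert v := v
  edge e := e
  ini_edge _ := rfl
  ter_edge _ := rfl
  lab_edge _ := rfl

/-- First `f`, then `g`. -/
def LGraph.Hom.trans {X : Type} {G H K : LGraph X} (f : G.Hom H) (g : H.Hom K) : G.Hom K where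
  vert v := g.vert (f.vert v)
  edge e := g.edge (f.edge e)
  ini_edge e := by rw [g.ini_edge, f.ini_edge]
  ter_edge e := by rw [g.ter_edge, f.ter_edge]
  lab_edge e := by rw [g.lab_edge, f.lab_edge]

/-- `f` is a quotient map that identifies `a` with `b` and nothing else
(if `a = b`, it identifies nothing). -/
def Identifies {α β : Type} (f : α → β) (a b : α) : Prop :=
  Function.Surjective f ∧ ∀ x y, f x = f y ↔ x = y ∨ (x = a ∧ y = b) ∨ (x = b ∧ y = a)

/-- An elementary folding: the quotient map that identifies two distinct edges `e₁`, `e₂` with the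
same label which both start (or both terminate) at a common vertex, together with their other
endpoints. -/
def LGraph.Hom.IsElementaryFolding {X : Type} {G H : LGraph X} (f : G.Hom H) : Prop :=
  ∃ e₁ e₂ : G.Edge, e₁ ≠ e₂ ∧ G.lab e₁ = G.lab e₂ ∧ Identifies f.edge e₁ e₂ ∧
    ((G.ini e₁ = G.ini e₂ ∧ Identifies f.vert (G.ter e₁) (G.ter e₂)) ∨
      (G.ter e₁ = G.ter e₂ ∧ Identifies f.vert (G.ini e₁) (G.ini e₂)))

/-- Compositions of finite (possibly empty) sequences of elementary foldings. -/
inductive IsFolding {X : Type} : {G H : LGraph X} → G.Hom H → Prop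
  | refl (G : LGraph X) : IsFolding (LGraph.Hom.id G)
  | step {G H K : LGraph X} (f : G.Hom H) (g : H.Hom K) :
      f.IsElementaryFolding → IsFolding g → IsFolding (f.trans g)

/-! ### The iterated logarithm -/

/-- `logStar m` is the least `k` such that the `k`-fold iterate of the base 2 logarithm,
applied to `m`, is at most 1. -/
noncomputable def logStar (m : ℕ) : ℕ :=
  sInf {k : ℕ | (Real.logb 2)^[k] (m : ℝ) ≤ 1}

/-! ### Programs and their running time

Objects are named by natural numbers. The memory consists of variables and of unary functions
(pointer fields), each of which sends objects to objects or numbers. Reading or changing a variable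
or a single value of a unary function costs one unit of time, and so does a comparison. The only
arithmetic is the successor, so that a program running for time `t` cannot produce numbers that
exceed both its constants and the numbers in the input by more than `t`. -/

/-- `reg r` is the value of the variable `r`; `fld f x` is the value at `x` of the function `f`. -/
structure Mem where
  reg : ℕ → ℕ
  fld : ℕ → ℕ → ℕ

/-- Comparisons between two variables. -/
inductive Test
  | eq (r s : ℕ)
  | ne (r s : ℕ)
  | lt (r s : ℕ)

/-- The truth value of a comparison. -/
def Test.Holds (m : Mem) : Test → Prop
  | .eq r s => m.reg r = m.reg s
  | .ne r s => m.reg r ≠ m.reg s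
  | .lt r s => m.reg r < m.reg s

/-- Primitive operations. -/
inductive Prim
  /-- do nothing -/
  | skip
  /-- `r := c` -/
  | const (r c : ℕ)
  /-- `r := s` -/
  | copy (r s : ℕ)
  /-- `r := r + 1` -/
  | succ (r : ℕ)
  /-- `r := f(s)` -/
  | load (r f s : ℕ)
  /-- `f(r) := s` -/
  | store (f r s : ℕ)

/-- The effect of a primitive operation. -/
def Prim.run (m : Mem) : Prim → Mem
  | .skip => m
  | .const r c => { m with reg := Function.update m.reg r c }
  | .copy r s => { m with reg := Function.update m.reg r (m.reg s) }
  | .succ r => { m with reg := Function.update m.reg r (m.reg r + 1) }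
  | .load r f s => { m with reg := Function.update m.reg r (m.fld f (m.reg s)) }
  | .store f r s =>
      { m with fld := Function.update m.fld f (Function.update (m.fld f) (m.reg r) (m.reg s)) }

/-- Programs. A program is a finite object, hence it mentions only finitely many variables and
functions. -/
inductive Prog
  | prim (p : Prim)
  | seq (c d : Prog)
  | ite (b : Test) (c d : Prog)
  | loop (b : Test) (c : Prog)

/-- `Exec c m t m'`: started in memory `m`, the program `c` terminates after time exactly `t` in
memory `m'`. Every primitive operation and every evaluation of a test takes one unit of time. -/
inductive Exec : Prog → Mem → ℕ → Mem → Prop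
  | prim (p : Prim) (m : Mem) : Exec (.prim p) m 1 (p.run m)
  | seq {c d : Prog} {m m' m'' : Mem} {t t' : ℕ} :
      Exec c m t m' → Exec d m' t' m'' → Exec (.seq c d) m (t + t') m''
  | ite_true {b : Test} {c d : Prog} {m m' : Mem} {t : ℕ} :
      b.Holds m → Exec c m t m' → Exec (.ite b c d) m (t + 1) m'
  | ite_false {b : Test} {c d : Prog} {m m' : Mem} {t : ℕ} :
      ¬ b.Holds m → Exec d m t m' → Exec (.ite b c d) m (t + 1) m'
  | loop_done {b : Test} {c : Prog} {m : Mem} :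
      ¬ b.Holds m → Exec (.loop b c) m 1 m
  | loop_step {b : Test} {c : Prog} {m m' m'' : Mem} {t t' : ℕ} :
      b.Holds m → Exec c m t m' → Exec (.loop b c) m' t' m'' →
        Exec (.loop b c) m (t + t' + 1) m''

/-! ### Graphs in memory -/

/-- A numbering of the vertices and edges of a (finite) graph by `0, …, numV - 1` and
`0, …, numE - 1`; thus `numV` and `numE` are the numbers of vertices and of edges. -/
structure Numbering {X : Type} (G : LGraph X) where
  numV : ℕ
  numE : ℕ
  vert : G.Vert ≃ Fin numV
  edge : G.Edge ≃ Fin numE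

/-- The memory holds the graph `G`, numbered by `N`: variables 0 and 1 hold the numbers of vertices
and of edges, the functions 0, 1, 2 hold the initial vertex, the terminal vertex and the label of
each edge. Nothing is required of the rest of the memory. -/
def Mem.Encodes {n : ℕ} (m : Mem) (G : LGraph (Fin n)) (N : Numbering G) : Prop :=
  m.reg 0 = N.numV ∧ m.reg 1 = N.numE ∧
    ∀ e : G.Edge, m.fld 0 (N.edge e) = N.vert (G.ini e) ∧
      m.fld 1 (N.edge e) = N.vert (G.ter e) ∧ m.fld 2 (N.edge e) = G.lab e

/-- The function 3 in memory holds the vertex map of `π`. -/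
def Mem.EncodesMap {n : ℕ} (m : Mem) {G H : LGraph (Fin n)} (π : G.Hom H)
    (N : Numbering G) (M : Numbering H) : Prop :=
  ∀ v : G.Vert, m.fld 3 (N.vert v) = M.vert (π.vert v)

end Stallings

/-!
Folding computes the least equivalence relation on the vertices for which edges with the same label
and equivalent initial (terminal) vertices have equivalent terminal (initial) vertices: the kernel
of an elementary folding lies in every such relation, and the kernel of a map to a folded graph is
such a relation.

This relation is computed with a union-find forest and a queue of pending identifications. For each
root, each label, and each direction, a table holds at most one half-edge, and a second one gives
rise to a pending identification of the two ends. Linking two roots moves the half-edges in the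
tables of the former root, a bounded number of them, so that only `O(V + E)` pairs enter the queue.

With union by rank and path halving, a search for a root takes time `O(log* V)`, apart from the
steps at nodes whose rank is on the same level as that of their parent. Such a step increases the
rank of the parent of the node, and a node on level `i` is passed in this way at most `tower i`
times before its parent reaches a higher level. As at most `V / 2 ^ r` nodes get rank `r`, there
are `O(V log* V)` such steps in all.
-/

namespace Stallings

open Function

/-! ### Fold-closed equivalence relations -/

section FoldClosed

variable {α β κ κ' : Type*}

/-- The equivalence relations that folding must respect. Here `H a k b` says that a half-edge of
type `k` leads from `a` to `b`; related sources must have related targets, type by type. -/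
def FoldClosed (H : α → κ → α → Prop) (r : Setoid α) : Prop :=
  ∀ ⦃a b a' b' k⦄, H a k b → H a' k b' → r a a' → r b b'

/-- The least fold-closed equivalence relation. -/
def foldSetoid (H : α → κ → α → Prop) : Setoid α := sInf {r | FoldClosed H r}

/-- The image of a system of half-edges under a map of the vertices and a map of the types. -/
def mapHalfEdges (H : α → κ → α → Prop) (f : α → β) (g : κ → κ') (a : β) (k : κ') (b : β) : Prop :=
  ∃ x i y, H x i y ∧ f x = a ∧ g i = k ∧ f y = b

variable {H : α → κ → α → Prop} {f : α → β} {g : κ → κ'}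

theorem foldClosed_foldSetoid : FoldClosed H (foldSetoid H) :=
  fun _ _ _ _ _ hb hb' h r hr => hr hb hb' (h r hr)

theorem foldSetoid_le {r : Setoid α} (h : FoldClosed H r) : foldSetoid H ≤ r := sInf_le h

theorem foldClosed_mapHalfEdges_iff (hg : Injective g) {s : Setoid β} :
    FoldClosed (mapHalfEdges H f g) s ↔ FoldClosed H (s.comap f) := by
  constructor
  · intro h a b a' b' k hb hb' hs
    exact h ⟨a, k, b, hb, rfl, rfl, rfl⟩ ⟨a', k, b', hb', rfl, rfl, rfl⟩ hs
  · rintro h - - - - - ⟨a, k, b, hb, rfl, rfl, rfl⟩ ⟨a', k', b', hb', rfl, hk, rfl⟩ hs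
    exact h hb (hg hk ▸ hb') hs

theorem comap_foldSetoid_mapHalfEdges (hf : Injective f) (hg : Injective g) :
    (foldSetoid (mapHalfEdges H f g)).comap f = foldSetoid H := by
  apply le_antisymm
  · have h : foldSetoid (mapHalfEdges H f g) ≤ (foldSetoid H).map f := by
      apply foldSetoid_le
      rw [foldClosed_mapHalfEdges_iff hg, Setoid.comap_map_eq _ _ hf]
      exact foldClosed_foldSetoid
    intro a b hab
    rw [← Setoid.comap_map_eq f (foldSetoid H) hf]
    exact h hab
  · exact foldSetoid_le ((foldClosed_mapHalfEdges_iff hg).1 foldClosed_foldSetoid)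

end FoldClosed

/-! ### Foldings -/

section Foldings

variable {X : Type} {G H : LGraph X}

/-- The half-edges of a graph: an edge labeled `x` can be passed forwards, which has type `inl x`,
and backwards, which has type `inr x`. -/
def LGraph.HalfEdge (G : LGraph X) (u : G.Vert) : X ⊕ X → G.Vert → Prop
  | .inl x, v => ∃ e, G.ini e = u ∧ G.lab e = x ∧ G.ter e = v
  | .inr x, v => ∃ e, G.ter e = u ∧ G.lab e = x ∧ G.ini e = v

theorem LGraph.Hom.halfEdge_eq_mapHalfEdges (f : G.Hom H) (hf : Surjective f.edge) :
    H.HalfEdge = mapHalfEdges G.HalfEdge f.vert _root_.id := by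
  ext a k b
  constructor
  · rcases k with x | x <;> rintro ⟨e, rfl, rfl, rfl⟩ <;> obtain ⟨e, rfl⟩ := hf e
    · exact ⟨_, .inl _, _, ⟨e, rfl, rfl, rfl⟩, (f.ini_edge e).symm, by simp [f.lab_edge],
        (f.ter_edge e).symm⟩
    · exact ⟨_, .inr _, _, ⟨e, rfl, rfl, rfl⟩, (f.ter_edge e).symm, by simp [f.lab_edge],
        (f.ini_edge e).symm⟩
  · rintro ⟨_, x | x, _, ⟨e, rfl, rfl, rfl⟩, rfl, rfl, rfl⟩
    · exact ⟨f.edge e, f.ini_edge e, f.lab_edge e, f.ter_edge e⟩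
    · exact ⟨f.edge e, f.ter_edge e, f.lab_edge e, f.ini_edge e⟩

theorem LGraph.Hom.foldClosed_ker (f : G.Hom H) (hH : H.Folded) :
    FoldClosed G.HalfEdge (Setoid.ker f.vert) := by
  rintro _ _ _ _ (x | x) ⟨e, rfl, rfl, rfl⟩ ⟨e', rfl, hl, rfl⟩ h <;>
    rw [Setoid.ker_def] at h ⊢ <;>
    have hl' : H.lab (f.edge e) = H.lab (f.edge e') := by rw [f.lab_edge, f.lab_edge, hl]
  · rw [← f.ini_edge, ← f.ini_edge] at h
    rw [← f.ter_edge, ← f.ter_edge, hH.1 _ _ hl' h]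
  · rw [← f.ter_edge, ← f.ter_edge] at h
    rw [← f.ini_edge, ← f.ini_edge, hH.2 _ _ hl' h]

theorem Identifies.ker_le {α β : Type} {f : α → β} {a b : α} (hf : Identifies f a b)
    {r : Setoid α} (hr : r a b) : Setoid.ker f ≤ r := by
  intro x y hxy
  obtain rfl | ⟨rfl, rfl⟩ | ⟨rfl, rfl⟩ := (hf.2 x y).1 hxy
  exacts [r.refl _, hr, r.symm hr]

theorem LGraph.Hom.IsElementaryFolding.surjective_vert {f : G.Hom H}
    (hf : f.IsElementaryFolding) : Surjective f.vert := by
  obtain ⟨e₁, e₂, -, -, -, ⟨-, hv⟩ | ⟨-, hv⟩⟩ := hf <;> exact hv.1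

theorem LGraph.Hom.IsElementaryFolding.surjective_edge {f : G.Hom H}
    (hf : f.IsElementaryFolding) : Surjective f.edge := by
  obtain ⟨e₁, e₂, -, -, he, -⟩ := hf
  exact he.1

theorem LGraph.Hom.IsElementaryFolding.ker_vert_le {f : G.Hom H} (hf : f.IsElementaryFolding)
    {r : Setoid G.Vert} (hr : FoldClosed G.HalfEdge r) : Setoid.ker f.vert ≤ r := by
  obtain ⟨e₁, e₂, -, hl, -, ⟨he, hv⟩ | ⟨he, hv⟩⟩ := hf
  · exact hv.ker_le (hr (k := .inl _) ⟨e₁, he, hl, rfl⟩ ⟨e₂, rfl, rfl, rfl⟩ (r.refl _))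
  · exact hv.ker_le (hr (k := .inr _) ⟨e₁, he, hl, rfl⟩ ⟨e₂, rfl, rfl, rfl⟩ (r.refl _))

theorem IsFolding.surjective_vert {f : G.Hom H} (hf : IsFolding f) :
    Surjective f.vert := by
  induction hf with
  | refl G => exact surjective_id
  | step f g hf _ ih => exact ih.comp hf.surjective_vert

theorem IsFolding.surjective_edge {f : G.Hom H} (hf : IsFolding f) :
    Surjective f.edge := by
  induction hf with
  | refl G => exact surjective_id
  | step f g hf _ ih => exact ih.comp hf.surjective_edge

theorem IsFolding.ker_vert_le {f : G.Hom H} (hf : IsFolding f) {r : Setoid G.Vert}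
    (hr : FoldClosed G.HalfEdge r) : Setoid.ker f.vert ≤ r := by
  induction hf with
  | refl G =>
    rintro u v rfl
    exact r.refl u
  | step f g hf _ ih =>
    have hcomap : (r.map f.vert).comap f.vert = r :=
      Setoid.comap_map_of_ker_le _ _ (hf.ker_vert_le hr)
    have hmap : Setoid.ker g.vert ≤ r.map f.vert := by
      apply ih
      rwa [f.halfEdge_eq_mapHalfEdges hf.surjective_edge,
        foldClosed_mapHalfEdges_iff injective_id, hcomap]
    intro u v huv
    rw [← hcomap]
    exact hmap huv

theorem IsFolding.ker_vert_eq_foldSetoid {f : G.Hom H} (hf : IsFolding f) (hH : H.Folded) :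
    Setoid.ker f.vert = foldSetoid G.HalfEdge :=
  le_antisymm (hf.ker_vert_le foldClosed_foldSetoid) (foldSetoid_le (f.foldClosed_ker hH))

/-- The quotient of a graph by compatible equivalence relations on its vertices and edges. -/
def LGraph.quotient (G : LGraph X) (r : Setoid G.Vert) (s : Setoid G.Edge)
    (h : ∀ e e', s e e' → r (G.ini e) (G.ini e') ∧ r (G.ter e) (G.ter e') ∧ G.lab e = G.lab e') :
    LGraph X where
  Vert := Quotient r
  Edge := Quotient s
  ini := Quotient.map G.ini fun e e' he => (h e e' he).1
  ter := Quotient.map G.ter fun e e' he => (h e e' he).2.1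
  lab := Quotient.lift G.lab fun e e' he => (h e e' he).2.2

/-- The equivalence relation that identifies `a` with `b` and nothing else. -/
def identifySetoid {α : Type} (a b : α) : Setoid α where
  r x y := x = y ∨ (x = a ∧ y = b) ∨ (x = b ∧ y = a)
  iseqv := ⟨fun _ => Or.inl rfl, by grind, by grind⟩

theorem identifies_mk {α : Type} (a b : α) :
    Identifies (Quotient.mk (identifySetoid a b)) a b :=
  ⟨Quotient.mk_surjective, fun _ _ => Quotient.eq⟩

theorem identifySetoid_map {α β : Type} {a b x y : α} (f : α → β)
    (h : identifySetoid a b x y) {r : Setoid β} (hr : r (f a) (f b)) : r (f x) (f y) := by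
  obtain rfl | ⟨rfl, rfl⟩ | ⟨rfl, rfl⟩ := h
  exacts [r.refl _, hr, r.symm hr]

theorem LGraph.exists_isElementaryFolding (h : ¬ G.Folded) :
    ∃ (H : LGraph X) (f : G.Hom H), f.IsElementaryFolding := by
  have quotient_exists {e₁ e₂ : G.Edge} {a b : G.Vert} (hl : G.lab e₁ = G.lab e₂)
      (hi : identifySetoid a b (G.ini e₁) (G.ini e₂))
      (ht : identifySetoid a b (G.ter e₁) (G.ter e₂)) : ∃ (H : LGraph X) (f : G.Hom H),
      Identifies f.edge e₁ e₂ ∧ Identifies f.vert a b :=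
    ⟨G.quotient (identifySetoid a b) (identifySetoid e₁ e₂) fun e e' he =>
        ⟨identifySetoid_map G.ini he hi, identifySetoid_map G.ter he ht,
          identifySetoid_map (r := ⊥) G.lab he hl⟩,
      ⟨Quotient.mk _, Quotient.mk _, fun _ => rfl, fun _ => rfl, fun _ => rfl⟩,
      identifies_mk _ _, identifies_mk _ _⟩
  obtain ⟨e₁, e₂, hne, hl, hi | ht⟩ : ∃ e₁ e₂ : G.Edge, e₁ ≠ e₂ ∧ G.lab e₁ = G.lab e₂ ∧
      (G.ini e₁ = G.ini e₂ ∨ G.ter e₁ = G.ter e₂) := by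
    simp only [Folded] at h
    grind
  · obtain ⟨H, f, he, hv⟩ := quotient_exists hl (Or.inl hi) (Or.inr (Or.inl ⟨rfl, rfl⟩))
    exact ⟨H, f, e₁, e₂, hne, hl, he, Or.inl ⟨hi, hv⟩⟩
  · obtain ⟨H, f, he, hv⟩ := quotient_exists hl (Or.inr (Or.inl ⟨rfl, rfl⟩)) (Or.inl ht)
    exact ⟨H, f, e₁, e₂, hne, hl, he, Or.inr ⟨ht, hv⟩⟩

theorem LGraph.Hom.IsElementaryFolding.card_edge_lt {f : G.Hom H} (hf : f.IsElementaryFolding)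
    [Finite G.Edge] : Nat.card H.Edge < Nat.card G.Edge := by
  obtain ⟨e₁, e₂, hne, -, he, -⟩ := hf
  refine (Nat.card_le_card_of_surjective _ he.1).lt_of_ne fun hc => hne ?_
  have hinj := ((Nat.bijective_iff_surjective_and_card f.edge).2 ⟨he.1, hc.symm⟩).1
  exact hinj ((he.2 e₁ e₂).2 (Or.inr (Or.inl ⟨rfl, rfl⟩)))

theorem LGraph.exists_isFolding (G : LGraph X) [Finite G.Edge] :
    ∃ (H : LGraph X) (f : G.Hom H), IsFolding f ∧ H.Folded := by
  induction hk : Nat.card G.Edge using Nat.strong_induction_on generalizing G with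
  | _ k ih =>
    by_cases h : G.Folded
    · exact ⟨G, _, IsFolding.refl G, h⟩
    · obtain ⟨H, f, hf⟩ := exists_isElementaryFolding h
      have : Finite H.Edge := Finite.of_surjective _ hf.surjective_edge
      obtain ⟨K, g, hg, hK⟩ := ih _ (hk ▸ hf.card_edge_lt) H rfl
      exact ⟨K, _, IsFolding.step f g hf hg, hK⟩

end Foldings

/-! ### Towers of exponentials and the iterated logarithm -/

/-- The tower of `i` twos, the inverse of the iterated logarithm. -/
def tower : ℕ → ℕ
  | 0 => 1
  | i + 1 => 2 ^ tower i

theorem tower_lt_succ (i : ℕ) : tower i < tower (i + 1) := Nat.lt_two_pow_self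

theorem tower_strictMono : StrictMono tower := strictMono_nat_of_lt_succ tower_lt_succ

theorem lt_tower (i : ℕ) : i < tower i := by
  induction i with
  | zero => exact Nat.zero_lt_one
  | succ i ih => exact (Nat.succ_le_of_lt ih).trans_lt (tower_lt_succ i)

theorem exists_lt_tower (r : ℕ) : ∃ i, r < tower i := ⟨r, lt_tower r⟩

/-- The least `i` such that `r` is below the tower of `i` twos. The levels group the ranks of the
nodes of a union-find forest. -/
def level (r : ℕ) : ℕ := Nat.find (exists_lt_tower r)

theorem lt_tower_level (r : ℕ) : r < tower (level r) := Nat.find_spec (exists_lt_tower r)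

theorem level_le_of_lt_tower {r i : ℕ} (h : r < tower i) : level r ≤ i := Nat.find_min' _ h

theorem level_zero : level 0 = 0 := Nat.le_zero.1 (level_le_of_lt_tower Nat.zero_lt_one)

theorem level_mono : Monotone level :=
  fun _ s h => level_le_of_lt_tower (h.trans_lt (lt_tower_level s))

theorem level_lt_of_tower_le {r s : ℕ} (h : tower (level r) ≤ s) : level r < level s :=
  tower_strictMono.lt_iff_lt.1 (h.trans_lt (lt_tower_level s))

theorem level_succ (r : ℕ) :
    level (r + 1) = level r ∨ (level (r + 1) = level r + 1 ∧ tower (level r) = r + 1) := by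
  rcases (Nat.succ_le_of_lt (lt_tower_level r)).lt_or_eq with h | h
  · exact Or.inl ((level_le_of_lt_tower h).antisymm (level_mono r.le_succ))
  · refine Or.inr ⟨(level_le_of_lt_tower ?_).antisymm (level_lt_of_tower_le h.ge), h.symm⟩
    exact h.trans_lt (tower_lt_succ _)

theorem le_tower_of_iterate_logb_le_one {k : ℕ} {x : ℝ} (h : (Real.logb 2)^[k] x ≤ 1) :
    x ≤ tower k := by
  induction k generalizing x with
  | zero => simpa [tower] using h
  | succ k ih =>
    rcases le_or_gt x 0 with hx | hx
    · exact hx.trans (Nat.cast_nonneg _)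
    · have hlog := ih h
      rw [Real.logb_le_iff_le_rpow one_lt_two hx] at hlog
      simpa [tower] using hlog

theorem tower_lt_of_one_lt_iterate_logb {k : ℕ} {x : ℝ}
    (h : ∀ j ≤ k, 1 < (Real.logb 2)^[j] x) : (tower k : ℝ) < x := by
  induction k generalizing x with
  | zero => simpa [tower] using h 0 le_rfl
  | succ k ih =>
    have hx : 1 < x := h 0 (Nat.zero_le _)
    have hlog := ih (x := Real.logb 2 x) fun j hj => h (j + 1) (Nat.succ_le_succ hj)
    rw [Real.lt_logb_iff_rpow_lt one_lt_two (zero_lt_one.trans hx)] at hlog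
    simpa [tower] using hlog

theorem le_tower_logStar (m : ℕ) : m ≤ tower (logStar m) := by
  have hne : {k : ℕ | (Real.logb 2)^[k] (m : ℝ) ≤ 1}.Nonempty := by
    by_contra! hempty
    have hlt : (tower m : ℝ) < m := tower_lt_of_one_lt_iterate_logb fun j _ =>
      not_le.1 (Set.eq_empty_iff_forall_notMem.1 hempty j)
    exact (lt_tower m).not_gt (by exact_mod_cast hlt)
  exact_mod_cast le_tower_of_iterate_logb_le_one (Nat.sInf_mem hne)

theorem logStar_of_le_one {m : ℕ} (h : m ≤ 1) : logStar m = 0 :=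
  Nat.le_zero.1 (Nat.sInf_le (by simpa using h))

theorem logStar_pos {m : ℕ} (h : 1 < m) : 0 < logStar m := by
  by_contra! h0
  have hm := le_tower_logStar m
  rw [Nat.le_zero.1 h0] at hm
  exact h.not_ge hm

theorem level_le_logStar {r m : ℕ} (h : 2 ^ r ≤ m) : level r ≤ logStar m :=
  level_le_of_lt_tower (Nat.lt_two_pow_self.trans_le (h.trans (le_tower_logStar m)))

theorem mul_logStar_succ_le (V E : ℕ) :
    (V + E + 1) * (logStar V + 1) ≤ 4 * max 1 (E + (V + E) * logStar V) := by
  rcases Nat.lt_or_ge 1 V with h | h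
  · have hpos := logStar_pos h
    calc (V + E + 1) * (logStar V + 1) ≤ (2 * (V + E)) * (2 * logStar V) :=
          Nat.mul_le_mul (by omega) (by omega)
      _ = 4 * ((V + E) * logStar V) := by ring
      _ ≤ _ := Nat.mul_le_mul_left _ ((Nat.le_add_left _ _).trans (le_max_right _ _))
  · rw [logStar_of_le_one h]
    omega

/-- The ranks up to `r`, counted with weight `tower (level j) / 2 ^ j` for the rank `j`. On each
level these weights form a geometric progression of sum at most 2; the closed form here bounds
their sum. -/
def rankWeight (r : ℕ) : ℚ := 2 * (level r + 1) - tower (level r) / 2 ^ r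

theorem rankWeight_zero : rankWeight 0 = 1 := by
  norm_num [rankWeight, level_zero, tower]

theorem rankWeight_le (r : ℕ) : rankWeight r ≤ 2 * (level r + 1) :=
  sub_le_self _ (by positivity)

theorem rankWeight_succ (r : ℕ) :
    rankWeight r + tower (level (r + 1)) / 2 ^ (r + 1) ≤ rankWeight (r + 1) := by
  unfold rankWeight
  rcases level_succ r with h | ⟨h, h'⟩
  · rw [h, pow_succ]
    have hhalf : (tower (level r) : ℚ) / 2 ^ r = 2 * (tower (level r) / (2 ^ r * 2)) := by
      field_simp
    linarith
  · have htower : (tower (level (r + 1)) : ℚ) = 2 ^ (r + 1) := by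
      rw [h, tower, h']
      push_cast
      rfl
    rw [htower, div_self (by positivity), h]
    have hnonneg : (0 : ℚ) ≤ tower (level r) / 2 ^ r := by positivity
    push_cast
    linarith

theorem rankWeight_mono : Monotone rankWeight := monotone_nat_of_le_succ fun r =>
  (le_add_of_nonneg_right (by positivity)).trans (rankWeight_succ r)

/-! ### Union-find forests -/

section

open Finset

variable {V : ℕ} {par rk rt : ℕ → ℕ}

/-- The number of nodes in the tree with root `x`. -/
def treeSize (V : ℕ) (rt : ℕ → ℕ) (x : ℕ) : ℕ := #{y ∈ range V | rt y = x}

/-- The invariant of union-find with union by rank. The parent pointers `par` and the ranks `rk`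
form a forest on `0, …, V - 1`, whose roots are the fixed points of `par`; `rt` sends each node to
the root of its tree. The field `weight` bounds the total charge that the nodes can ever incur. -/
structure Forest (V : ℕ) (par rk rt : ℕ → ℕ) : Prop where
  par_lt : ∀ x < V, par x < V
  rk_lt : ∀ x < V, par x ≠ x → rk x < rk (par x)
  rt_par : ∀ x < V, rt (par x) = rt x
  rt_self : ∀ x < V, par x = x → rt x = x
  par_rt : ∀ x < V, par (rt x) = rt x
  rt_lt : ∀ x < V, rt x < V
  pow_le_treeSize : ∀ x < V, par x = x → 2 ^ rk x ≤ treeSize V rt x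
  weight : ∑ x ∈ range V, (tower (level (rk x)) : ℚ) ≤ ∑ x ∈ range V, rankWeight (rk (rt x))

/-- The potential that pays for path halving: a node that is not a root is charged each time the
rank of its parent grows, until that rank lies on a higher level than its own. -/
def charge (V : ℕ) (par rk : ℕ → ℕ) : ℕ :=
  ∑ x ∈ range V, if par x = x then 0 else min (rk (par x)) (tower (level (rk x)))

/-- The number of trees of a forest. -/
def numRoots (V : ℕ) (par : ℕ → ℕ) : ℕ := #{x ∈ range V | par x = x}

theorem numRoots_le (V : ℕ) (par : ℕ → ℕ) : numRoots V par ≤ V :=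
  (card_filter_le _ _).trans (card_range V).le

namespace Forest

theorem of_singletons (hp : ∀ x < V, par x = x) (hr : ∀ x < V, rk x = 0) :
    Forest V par rk fun x => x where
  par_lt x hx := by rwa [hp x hx]
  rk_lt x hx h := absurd (hp x hx) h
  rt_par x hx := hp x hx
  rt_self _ _ _ := rfl
  par_rt x hx := hp x hx
  rt_lt x hx := hx
  pow_le_treeSize x hx _ := by
    rw [hr x hx, pow_zero, Nat.one_le_iff_ne_zero]
    exact card_ne_zero_of_mem (mem_filter.2 ⟨mem_range.2 hx, rfl⟩)
  weight := sum_le_sum fun x hx => by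
    simp [hr x (mem_range.1 hx), rankWeight_zero, level_zero, tower]

section

variable (F : Forest V par rk rt) {x : ℕ}
include F

theorem rt_rt (hx : x < V) : rt (rt x) = rt x := F.rt_self _ (F.rt_lt x hx) (F.par_rt x hx)

theorem rk_le_par (hx : x < V) : rk x ≤ rk (par x) := by
  by_cases h : par x = x
  · rw [h]
  · exact (F.rk_lt x hx h).le

theorem par_eq_of_par_par_eq (hx : x < V) (h : par (par x) = x) : par x = x := by
  by_contra hne
  have hle := F.rk_le_par (F.par_lt x hx)
  rw [h] at hle
  exact (F.rk_lt x hx hne).not_ge hle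

theorem pow_rk_le (hx : x < V) : 2 ^ rk x ≤ V := by
  obtain ⟨y, hy, hmax⟩ := exists_max_image (range V) rk ⟨x, mem_range.2 hx⟩
  have hyV := mem_range.1 hy
  have hroot : par y = y := by
    by_contra hne
    exact (F.rk_lt y hyV hne).not_ge (hmax _ (mem_range.2 (F.par_lt y hyV)))
  calc 2 ^ rk x ≤ 2 ^ rk y := Nat.pow_le_pow_right two_pos (hmax x (mem_range.2 hx))
    _ ≤ treeSize V rt y := F.pow_le_treeSize y hyV hroot
    _ ≤ V := (card_filter_le _ _).trans (card_range V).le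

theorem rk_lt_card (hx : x < V) : rk x < V := Nat.lt_two_pow_self.trans_le (F.pow_rk_le hx)

theorem level_rk_le (hx : x < V) : level (rk x) ≤ logStar V := level_le_logStar (F.pow_rk_le hx)

theorem charge_le : charge V par rk ≤ 2 * V * (logStar V + 1) := by
  have hmin : (charge V par rk : ℚ) ≤ ∑ x ∈ range V, (tower (level (rk x)) : ℚ) := by
    rw [charge, Nat.cast_sum]
    refine sum_le_sum fun x _ => ?_
    split_ifs
    · positivity
    · exact_mod_cast min_le_right _ _
  have hlevel : ∑ x ∈ range V, rankWeight (rk (rt x)) ≤ ∑ x ∈ range V, 2 * (logStar V + 1 : ℚ) := by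
    refine sum_le_sum fun x hx => (rankWeight_le _).trans ?_
    gcongr
    exact F.level_rk_le (F.rt_lt x (mem_range.1 hx))
  rw [sum_const, card_range, nsmul_eq_mul, ← mul_assoc, mul_comm (V : ℚ)] at hlevel
  exact_mod_cast hmin.trans (F.weight.trans hlevel)

theorem halve_isRoot_iff {y : ℕ} (hx : x < V) :
    update par x (par (par x)) y = y ↔ par y = y := by
  rcases eq_or_ne y x with rfl | h
  · rw [update_self]
    exact ⟨F.par_eq_of_par_par_eq hx, fun h => by rw [h, h]⟩
  · rw [update_of_ne h]

theorem halve (hx : x < V) : Forest V (update par x (par (par x))) rk rt where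
  par_lt y hy := by
    rw [update_apply]
    split_ifs
    exacts [F.par_lt _ (F.par_lt x hx), F.par_lt y hy]
  rk_lt y hy hne := by
    have hlt := F.rk_lt y hy (mt (F.halve_isRoot_iff hx).2 hne)
    rw [update_apply]
    split_ifs with h
    exacts [h ▸ hlt.trans_le (h ▸ F.rk_le_par (F.par_lt x hx)), hlt]
  rt_par y hy := by
    rw [update_apply]
    split_ifs with h
    exacts [by rw [F.rt_par _ (F.par_lt x hx), F.rt_par x hx, h], F.rt_par y hy]
  rt_self y hy h := F.rt_self y hy ((F.halve_isRoot_iff hx).1 h)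
  par_rt y hy := (F.halve_isRoot_iff hx).2 (F.par_rt y hy)
  rt_lt := F.rt_lt
  pow_le_treeSize y hy h := F.pow_le_treeSize y hy ((F.halve_isRoot_iff hx).1 h)
  weight := F.weight

theorem numRoots_halve (hx : x < V) :
    numRoots V (update par x (par (par x))) = numRoots V par := by
  simp only [numRoots, F.halve_isRoot_iff hx]

theorem charge_term_le_halve (hx : x < V) (y : ℕ) :
    (if par y = y then 0 else min (rk (par y)) (tower (level (rk y)))) ≤
      if update par x (par (par x)) y = y then 0
        else min (rk (update par x (par (par x)) y)) (tower (level (rk y))) := by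
  simp only [F.halve_isRoot_iff hx]
  split_ifs
  · exact le_rfl
  · rcases eq_or_ne y x with rfl | h
    · rw [update_self]
      exact min_le_min_right _ (F.rk_le_par (F.par_lt y hx))
    · rw [update_of_ne h]

theorem charge_le_charge_halve (hx : x < V) :
    charge V par rk ≤ charge V (update par x (par (par x))) rk :=
  sum_le_sum fun y _ => F.charge_term_le_halve hx y

theorem charge_lt_charge_halve (hx : x < V) (h₁ : par x ≠ x) (h₂ : par (par x) ≠ par x)
    (h₃ : rk (par x) < tower (level (rk x))) :
    charge V par rk < charge V (update par x (par (par x))) rk := by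
  refine sum_lt_sum (fun y _ => F.charge_term_le_halve hx y) ⟨x, mem_range.2 hx, ?_⟩
  rw [if_neg h₁, if_neg (mt (F.halve_isRoot_iff hx).1 h₁), update_self]
  have hlt := F.rk_lt _ (F.par_lt x hx) h₂
  omega

theorem level_rk_le_level_rk_par_par (hx : x < V) :
    level (rk x) ≤ level (rk (par (par x))) :=
  level_mono ((F.rk_le_par hx).trans (F.rk_le_par (F.par_lt x hx)))

/-- Each halving step is paid for by the charge or by an increase of the level. -/
theorem charge_add_level_lt_halve (hx : x < V) (h₁ : par x ≠ x) (h₂ : par (par x) ≠ par x) :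
    charge V par rk + level (rk x) <
      charge V (update par x (par (par x))) rk + level (rk (par (par x))) := by
  rcases lt_or_ge (rk (par x)) (tower (level (rk x))) with h | h
  · exact add_lt_add_of_lt_of_le (F.charge_lt_charge_halve hx h₁ h₂ h)
      (F.level_rk_le_level_rk_par_par hx)
  · exact add_lt_add_of_le_of_lt (F.charge_le_charge_halve hx)
      ((level_lt_of_tower_le h).trans_le (level_mono (F.rk_le_par (F.par_lt x hx))))

end

/-- `u` and `w` are distinct roots, and `r` is the rank that `w` receives when union by rank makes
`u` a child of `w`. -/
structure Linkable (V : ℕ) (par rk : ℕ → ℕ) (u w r : ℕ) : Prop where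
  left_lt : u < V
  right_lt : w < V
  ne : u ≠ w
  par_left : par u = u
  par_right : par w = w
  rank : (r = rk w ∧ rk u < rk w) ∨ (r = rk w + 1 ∧ rk u = rk w)

variable {u w r : ℕ}

theorem Linkable.rk_left_lt (L : Linkable V par rk u w r) : rk u < r := by
  have := L.rank
  omega

theorem Linkable.rk_right_le (L : Linkable V par rk u w r) : rk w ≤ r := by
  have := L.rank
  omega

theorem Linkable.rk_le_update (L : Linkable V par rk u w r) (x : ℕ) : rk x ≤ update rk w r x := by
  rcases eq_or_ne x w with rfl | h
  · rw [update_self]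
    exact L.rk_right_le
  · rw [update_of_ne h]

theorem treeSize_link (huw : u ≠ w) :
    treeSize V (fun x => if rt x = u then w else rt x) w = treeSize V rt u + treeSize V rt w := by
  have hdisj : Disjoint {x ∈ range V | rt x = u} {x ∈ range V | rt x = w} :=
    disjoint_filter.2 fun x _ hu hw => huw (hu.symm.trans hw)
  rw [treeSize, treeSize, treeSize, ← card_union_of_disjoint hdisj, ← filter_or]
  congr 1
  ext x
  simp only [mem_filter]
  grind

theorem pow_le_treeSize_link (F : Forest V par rk rt) (L : Linkable V par rk u w r) :
    2 ^ r ≤ treeSize V (fun x => if rt x = u then w else rt x) w := by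
  have hu := F.pow_le_treeSize u L.left_lt L.par_left
  have hw := F.pow_le_treeSize w L.right_lt L.par_right
  rw [treeSize_link L.ne]
  obtain ⟨h, -⟩ | ⟨h, huw⟩ := L.rank
  · exact (h ▸ hw).trans (Nat.le_add_left _ _)
  · rw [h, pow_succ, mul_two]
    exact Nat.add_le_add (huw ▸ hu) hw

theorem Linkable.sum_tower_le (L : Linkable V par rk u w r) :
    ∑ x ∈ range V, (tower (level (update rk w r x)) : ℚ) ≤
      ∑ x ∈ range V, (tower (level (rk x)) : ℚ) + tower (level r) := by
  have hw : w ∈ range V := mem_range.2 L.right_lt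
  rw [← add_sum_erase _ _ hw, ← add_sum_erase _ (fun x => (tower (level (rk x)) : ℚ)) hw,
    update_self, sum_congr rfl fun x hx => by rw [update_of_ne (ne_of_mem_erase hx)]]
  linarith [Nat.cast_nonneg (α := ℚ) (tower (level (rk w)))]

/-- If the rank of `w` grows to `r`, then at least `2 ^ r` nodes have their root moved to rank `r`,
and each of them contributes `tower (level r) / 2 ^ r`. -/
theorem weight_link (F : Forest V par rk rt) (L : Linkable V par rk u w r) :
    ∑ x ∈ range V, (tower (level (update rk w r x)) : ℚ) ≤
      ∑ x ∈ range V, rankWeight (update rk w r (if rt x = u then w else rt x)) := by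
  obtain ⟨rfl, hlt⟩ | ⟨rfl, heq⟩ := L.rank
  · rw [update_eq_self]
    refine F.weight.trans (sum_le_sum fun x _ => rankWeight_mono ?_)
    split_ifs with h
    exacts [h ▸ hlt.le, le_rfl]
  set c : ℚ := tower (level (rk w + 1)) / 2 ^ (rk w + 1) with hc
  have hterm : ∀ x ∈ range V,
      rankWeight (rk (rt x)) + (if (if rt x = u then w else rt x) = w then c else 0) ≤
        rankWeight (update rk w (rk w + 1) (if rt x = u then w else rt x)) := by
    intro x _
    split_ifs with hu hw hw
    · rw [update_self, hu, heq]
      exact rankWeight_succ _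
    · exact absurd rfl hw
    · rw [hw, update_self]
      exact rankWeight_succ _
    · rw [update_of_ne hw, add_zero]
  have hcount : (tower (level (rk w + 1)) : ℚ) ≤
      treeSize V (fun x => if rt x = u then w else rt x) w * c := by
    rw [hc, mul_div_assoc', le_div_iff₀ (by positivity), mul_comm]
    gcongr
    exact_mod_cast F.pow_le_treeSize_link L
  have hsum := sum_le_sum hterm
  rw [sum_add_distrib, ← sum_filter, sum_const, nsmul_eq_mul] at hsum
  calc _ ≤ _ := L.sum_tower_le
    _ ≤ _ := add_le_add F.weight hcount
    _ ≤ _ := hsum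

theorem link (F : Forest V par rk rt) (L : Linkable V par rk u w r) :
    Forest V (update par u w) (update rk w r) fun x => if rt x = u then w else rt x where
  par_lt x hx := by
    rw [update_apply]
    split_ifs
    exacts [L.right_lt, F.par_lt x hx]
  rk_lt x hx hne := by
    rcases eq_or_ne x u with rfl | h
    · rw [update_self, update_self, update_of_ne L.ne]
      exact L.rk_left_lt
    · rw [update_of_ne h] at hne ⊢
      have hxw : x ≠ w := fun e => hne (e ▸ L.par_right)
      rw [update_of_ne hxw]
      exact (F.rk_lt x hx hne).trans_le (L.rk_le_update _)
  rt_par x hx := by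
    rcases eq_or_ne x u with rfl | h
    · have hw := F.rt_self w L.right_lt L.par_right
      simp only [update_self, hw, F.rt_self x hx L.par_left, if_true, ite_self]
    · simp only [update_of_ne h, F.rt_par x hx]
  rt_self x hx h := by
    have hxu : x ≠ u := fun e => L.ne (by rw [e, update_self] at h; exact h.symm)
    rw [update_of_ne hxu] at h
    rw [F.rt_self x hx h, if_neg hxu]
  par_rt x hx := by
    split_ifs with h
    · rw [update_of_ne L.ne.symm, L.par_right]
    · rw [update_of_ne h, F.par_rt x hx]
  rt_lt x hx := by
    split_ifs
    exacts [L.right_lt, F.rt_lt x hx]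
  pow_le_treeSize x hx h := by
    have hxu : x ≠ u := fun e => L.ne (by rw [e, update_self] at h; exact h.symm)
    rcases eq_or_ne x w with rfl | hxw
    · rw [update_self]
      exact F.pow_le_treeSize_link L
    · rw [update_of_ne hxu] at h
      rw [update_of_ne hxw]
      refine (F.pow_le_treeSize x hx h).trans (card_le_card fun y => ?_)
      simp only [mem_filter]
      grind
  weight := F.weight_link L

theorem Linkable.charge_le_charge (L : Linkable V par rk u w r) :
    charge V par rk ≤ charge V (update par u w) (update rk w r) := by
  refine sum_le_sum fun x _ => ?_
  rcases eq_or_ne x u with rfl | hxu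
  · rw [if_pos L.par_left]
    exact Nat.zero_le _
  · rw [update_of_ne hxu]
    split_ifs with h
    · exact le_rfl
    · have hxw : x ≠ w := fun e => h (e ▸ L.par_right)
      rw [update_of_ne hxw]
      exact min_le_min_right _ (L.rk_le_update _)

theorem Linkable.numRoots_lt (L : Linkable V par rk u w r) :
    numRoots V (update par u w) < numRoots V par := by
  have hmem : u ∈ {x ∈ range V | par x = x} :=
    mem_filter.2 ⟨mem_range.2 L.left_lt, L.par_left⟩
  refine card_lt_card ((ssubset_iff_of_subset fun x hx => ?_).2 ⟨u, hmem, fun hu => ?_⟩)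
  · rw [mem_filter] at hx ⊢
    rcases eq_or_ne x u with rfl | hxu
    · exact ⟨hx.1, L.par_left⟩
    · rwa [update_of_ne hxu] at hx
  · exact L.ne (by simpa using (mem_filter.1 hu).2.symm)

end Forest

end

/-! ### Reasoning about programs -/

section

/-- Started in memory `m`, the program `P` stops after some time `t` in some memory `m'` such that
`Q t m'`. -/
def Run (P : Prog) (m : Mem) (Q : ℕ → Mem → Prop) : Prop :=
  ∃ t m', Exec P m t m' ∧ Q t m'

variable {P P' : Prog} {b : Test} {m m' m'' : Mem} {Q Q' : ℕ → Mem → Prop}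

theorem Run.mono (h : Run P m Q) (hQ : ∀ t m', Q t m' → Q' t m') : Run P m Q' := by
  obtain ⟨t, m', he, hq⟩ := h
  exact ⟨t, m', he, hQ t m' hq⟩

theorem run_prim {p : Prim} : Run (.prim p) m Q ↔ Q 1 (p.run m) := by
  constructor
  · rintro ⟨t, m', he, hq⟩
    cases he
    exact hq
  · exact fun h => ⟨1, _, .prim p m, h⟩

theorem run_seq :
    Run (.seq P P') m Q ↔ Run P m fun t m' => Run P' m' fun t' m'' => Q (t + t') m'' := by
  constructor
  · rintro ⟨t, m', he, hq⟩
    cases he with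
    | seq h1 h2 => exact ⟨_, _, h1, _, _, h2, hq⟩
  · rintro ⟨t, m', he, t', m'', he', hq⟩
    exact ⟨_, _, .seq he he', hq⟩

theorem run_ite :
    Run (.ite b P P') m Q ↔
      (b.Holds m → Run P m fun t m' => Q (t + 1) m') ∧
        (¬ b.Holds m → Run P' m fun t m' => Q (t + 1) m') := by
  constructor
  · rintro ⟨t, m', he, hq⟩
    cases he with
    | ite_true hb h => exact ⟨fun _ => ⟨_, _, h, hq⟩, fun hn => absurd hb hn⟩
    | ite_false hb h => exact ⟨fun hn => absurd hn hb, fun _ => ⟨_, _, h, hq⟩⟩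
  · rintro ⟨h1, h2⟩
    by_cases hb : b.Holds m
    · obtain ⟨t, m', he, hq⟩ := h1 hb
      exact ⟨_, _, .ite_true hb he, hq⟩
    · obtain ⟨t, m', he, hq⟩ := h2 hb
      exact ⟨_, _, .ite_false hb he, hq⟩

/-- In the invariant `I k τ m`, the number `k` decreases and `τ` is the time spent so far. -/
theorem run_loop (I : ℕ → ℕ → Mem → Prop)
    (step : ∀ k τ m, I k τ m → b.Holds m → Run P m fun t m' => ∃ k' < k, I k' (τ + t + 1) m')
    {k τ : ℕ} (h : I k τ m) :
    Run (.loop b P) m fun t m' => ∃ k' τ', I k' τ' m' ∧ ¬ b.Holds m' ∧ τ' + 1 = τ + t := by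
  induction k using Nat.strong_induction_on generalizing τ m with
  | _ k ih =>
    by_cases hb : b.Holds m
    · obtain ⟨t, m', he, k', hk, hI⟩ := step k τ m h hb
      obtain ⟨t', m'', he', k'', τ', hI', hb', ht⟩ := ih k' hk hI
      exact ⟨_, _, .loop_step hb he he', k'', τ', hI', hb', by omega⟩
    · exact ⟨_, _, .loop_done hb, k, τ, h, hb, rfl⟩

/-- The memories `m` and `m'` agree except for the variables in `R` and the functions in `F`. -/
structure Mem.EqOff (R F : Set ℕ) (m m' : Mem) : Prop where
  reg : ∀ r ∉ R, m'.reg r = m.reg r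
  fld : ∀ f ∉ F, m'.fld f = m.fld f

theorem Mem.EqOff.refl (R F : Set ℕ) (m : Mem) : m.EqOff R F m :=
  ⟨fun _ _ => rfl, fun _ _ => rfl⟩

theorem Mem.EqOff.mono {R R' F F' : Set ℕ} (h : m.EqOff R F m')
    (hR : R ⊆ R' := by simp [Set.insert_subset_iff])
    (hF : F ⊆ F' := by simp) : m.EqOff R' F' m' :=
  ⟨fun r hr => h.reg r fun hr' => hr (hR hr'), fun f hf => h.fld f fun hf' => hf (hF hf')⟩

theorem Mem.EqOff.trans {R R' F F' : Set ℕ} (h : m.EqOff R F m') (h' : m'.EqOff R' F' m'') :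
    m.EqOff (R ∪ R') (F ∪ F') m'' :=
  ⟨fun r hr => (h'.reg r fun hr' => hr (.inr hr')).trans (h.reg r fun hr' => hr (.inl hr')),
    fun f hf => (h'.fld f fun hf' => hf (.inr hf')).trans (h.fld f fun hf' => hf (.inl hf'))⟩

theorem Mem.EqOff.update_fld {R F : Set ℕ} (h : m.EqOff R F m') {f : ℕ} {g : ℕ → ℕ} (hf : f ∈ F) :
    m.EqOff R F { m' with fld := update m'.fld f g } :=
  ⟨h.reg, fun f' hf' =>
    (update_of_ne (ne_of_mem_of_not_mem hf hf').symm _ _).trans (h.fld f' hf')⟩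

/-- Run `P` for the values `0, 1, …` of the variable `i` below the value of the variable `l`. -/
def forLoop (i l : ℕ) (P : Prog) : Prog :=
  .seq (.prim (.const i 0)) (.loop (.lt i l) (.seq P (.prim (.succ i))))

theorem run_forLoop {i l : ℕ} {R F : Set ℕ} (I : ℕ → ℕ → Mem → Prop)
    (step : ∀ j < m.reg l, ∀ τ m₁, m.EqOff (insert i R) F m₁ → m₁.reg i = j → I j τ m₁ →
      Run P m₁ fun t m' => m₁.EqOff R F m' ∧
        I (j + 1) (τ + t + 2) { m' with reg := update m'.reg i (j + 1) })
    (h : I 0 0 { m with reg := update m.reg i 0 })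
    (hi : i ∉ R := by simp) (hl : l ∉ insert i R := by simp) :
    Run (forLoop i l P) m fun t m' =>
      m.EqOff (insert i R) F m' ∧ ∃ τ, I (m.reg l) τ m' ∧ t = τ + 2 := by
  rw [forLoop, run_seq, run_prim]
  refine (run_loop (fun k τ m₁ => m.EqOff (insert i R) F m₁ ∧ m₁.reg i + k = m.reg l ∧
    I (m₁.reg i) τ m₁) ?_ (k := m.reg l) (τ := 0) ?_).mono ?_
  · rintro k τ m₁ ⟨hE, hk, hI⟩ (hb : m₁.reg i < m₁.reg l)
    rw [hE.reg l hl] at hb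
    rw [run_seq]
    refine (step _ hb τ m₁ hE rfl hI).mono fun t m' ⟨hE', hI'⟩ => run_prim.2 ?_
    have hi' : m'.reg i = m₁.reg i := hE'.reg i hi
    simp only [Prim.run, update_self, hi']
    refine ⟨k - 1, by omega, ⟨fun r hr => ?_, fun f hf => ?_⟩, by omega, hI'⟩
    · refine (update_of_ne (fun e : r = i => hr (.inl e)) _ _).trans ?_
      rw [hE'.reg r fun h => hr (.inr h), hE.reg r hr]
    · rw [hE'.fld f hf, hE.fld f hf]
  · simp only [Prim.run, update_self]
    exact ⟨⟨fun r hr => update_of_ne (fun e : r = i => hr (.inl e)) _ _, fun _ _ => rfl⟩,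
      Nat.zero_add _, h⟩
  · rintro t m' ⟨k, τ, ⟨hE, hk, hI⟩, (hb : ¬ m'.reg i < m'.reg l), ht⟩
    rw [hE.reg l hl] at hb
    exact ⟨hE, τ, by rwa [show m.reg l = m'.reg i by omega], by omega⟩

/-- The programs `f 0`, …, `f (K - 1)` in succession. -/
def unroll (f : ℕ → Prog) : ℕ → Prog
  | 0 => .prim .skip
  | K + 1 => .seq (unroll f K) (f K)

theorem run_unroll {f : ℕ → Prog} {K : ℕ} {R F : Set ℕ} (I : ℕ → ℕ → Mem → Prop)
    (step : ∀ k < K, ∀ τ m₁, m.EqOff R F m₁ → I k τ m₁ →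
      Run (f k) m₁ fun t m' => m₁.EqOff R F m' ∧ I (k + 1) (τ + t) m')
    (h : I 0 0 m) :
    Run (unroll f K) m fun t m' => m.EqOff R F m' ∧ ∃ τ, I K τ m' ∧ t = τ + 1 := by
  induction K with
  | zero => exact run_prim.2 ⟨.refl _ _ _, 0, h, rfl⟩
  | succ K ih =>
    rw [unroll, run_seq]
    refine (ih fun k hk => step k (hk.trans K.lt_succ_self)).mono ?_
    rintro t m' ⟨hE, τ, h', rfl⟩
    exact (step K K.lt_succ_self τ m' hE h').mono fun t' m'' ⟨hE', h''⟩ =>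
      ⟨(hE.trans hE').mono, _, h'', by omega⟩

/-- The case distinction that runs `f k`, where `k < K` is the value of the variable `r`. It uses
the variable `s` as scratch space. -/
def dispatch (r s : ℕ) (f : ℕ → Prog) : ℕ → Prog
  | 0 => .prim .skip
  | K + 1 => .seq (.prim (.const s K)) (.ite (.eq r s) (f K) (dispatch r s f K))

theorem run_dispatch {r s : ℕ} (hrs : r ≠ s) {f : ℕ → Prog} {K : ℕ} (hK : m.reg r < K)
    (h : Run (f (m.reg r)) { m with reg := update m.reg s (m.reg r) } Q) :
    Run (dispatch r s f K) m fun t m' => ∃ t', Q t' m' ∧ t ≤ t' + 2 * K := by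
  induction K generalizing m with
  | zero => exact absurd hK (Nat.not_lt_zero _)
  | succ K ih =>
    simp only [dispatch, run_seq, run_prim, run_ite, Prim.run, Test.Holds, update_self,
      update_of_ne hrs]
    constructor
    · rintro rfl
      exact h.mono fun t m' hq => ⟨t, hq, by omega⟩
    · intro hne
      have hlt : m.reg r < K := by omega
      refine (ih (by simpa [hrs] using hlt) (by simpa [hrs] using h)).mono ?_
      rintro t m' ⟨t', hq, ht⟩
      exact ⟨t', hq, by omega⟩

end

/-! ### Instructions and memory layout -/

/-- The instruction `r := c`. -/
abbrev Prog.const (r c : ℕ) : Prog := .prim (.const r c)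

/-- The instruction `r := s`. -/
abbrev Prog.copy (r s : ℕ) : Prog := .prim (.copy r s)

/-- The instruction `r := r + 1`. -/
abbrev Prog.succ (r : ℕ) : Prog := .prim (.succ r)

/-- The instruction `r := f(s)`. -/
abbrev Prog.load (r f s : ℕ) : Prog := .prim (.load r f s)

/-- The instruction `f(r) := s`. -/
abbrev Prog.store (f r s : ℕ) : Prog := .prim (.store f r s)

local infixr:60 " ;; " => Prog.seq

/- The first variables and functions are those prescribed by `Mem.Encodes` and `Mem.EncodesMap`.
The functions `k + fTable` are the tables, for `k` less than twice the number of labels. -/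

local notation "rVerts" => 0
local notation "rEdges" => 1
local notation "rIdx" => 2
local notation "rHead" => 3
local notation "rTail" => 4
local notation "rRoots" => 5
local notation "rOut" => 6
local notation "rZero" => 7
local notation "rNode" => 8
local notation "rPar" => 9
local notation "rRoot" => 10
local notation "rSnd" => 11
local notation "rRankLeft" => 12
local notation "rRankRight" => 13
local notation "rTmp" => 14
local notation "rSrc" => 15
local notation "rTgt" => 16
local notation "rOld" => 17
local notation "rLab" => 18
local notation "rCase" => 19

local notation "fIni" => 0
local notation "fTer" => 1
local notation "fLab" => 2
local notation "fMap" => 3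
local notation "fPar" => 4
local notation "fRank" => 5
local notation "fFst" => 6
local notation "fSnd" => 7
local notation "fNum" => 8
local notation "fTable" => 9

/-! ### Finding roots -/

section

variable {V : ℕ} {rt : ℕ → ℕ} {m m₁ : Mem} {τ : ℕ}

/-- Let the node in `rNode`, whose parent is in `rPar`, point to its grandparent, and go there. -/
def halveStep : Prog :=
  .load rPar fPar rPar ;; .store fPar rNode rPar ;; .copy rNode rPar ;; .load rPar fPar rNode

/-- Replace the node in `rNode` by its root, halving the path to it. -/
def findRoot : Prog :=
  .load rPar fPar rNode ;; .loop (.ne rPar rNode) halveStep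

/-- Between `m` and `m'`, nothing has happened except for some halving steps. -/
structure Compressed (V : ℕ) (rt : ℕ → ℕ) (m m' : Mem) : Prop where
  forest : Forest V (m'.fld fPar) (m'.fld fRank) rt
  eqOff : m.EqOff {rNode, rPar} {fPar} m'
  numRoots_eq : numRoots V (m'.fld fPar) = numRoots V (m.fld fPar)
  charge_le : charge V (m.fld fPar) (m.fld fRank) ≤ charge V (m'.fld fPar) (m'.fld fRank)

/-- The invariant of the loop of `findRoot`, started in memory `m`, after time `τ`. -/
structure Climbing (V : ℕ) (rt : ℕ → ℕ) (m : Mem) (τ : ℕ) (m' : Mem) : Prop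
    extends Compressed V rt m m' where
  node_lt : m'.reg rNode < V
  par_eq : m'.reg rPar = m'.fld fPar (m'.reg rNode)
  rt_node : rt (m'.reg rNode) = rt (m.reg rNode)
  time_le : τ + 5 * charge V (m.fld fPar) (m.fld fRank) ≤
    5 * charge V (m'.fld fPar) (m'.fld fRank) + 5 * level (m'.fld fRank (m'.reg rNode)) +
      if m'.fld fPar (m'.reg rNode) = m'.reg rNode then 5 else 0

theorem run_halveStep (h : Climbing V rt m τ m₁) (hne : m₁.reg rPar ≠ m₁.reg rNode) :
    Run halveStep m₁ fun t m' => m₁.fld fRank (m₁.reg rNode) < m'.fld fRank (m'.reg rNode) ∧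
      Climbing V rt m (τ + t + 1) m' := by
  obtain ⟨⟨F, hE, hnum, hch⟩, hx, hp, hrt, hτ⟩ := h
  rw [hp] at hne
  rw [if_neg hne] at hτ
  simp +decide only [halveStep, run_seq, run_prim, Prim.run, update_self, update_of_ne, hp, ne_eq]
  generalize m₁.reg rNode = x at *
  have hpV := F.par_lt x hx
  refine ⟨(F.rk_lt x hx hne).trans_le (F.rk_le_par hpV),
    ⟨F.halve hx, (hE.trans (R' := {rNode, rPar}) (F' := {fPar}) ?_).mono,
      (F.numRoots_halve hx).trans hnum, hch.trans (F.charge_le_charge_halve hx)⟩,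
    F.par_lt _ hpV, rfl, (F.rt_par _ hpV).trans ((F.rt_par x hx).trans hrt), ?_⟩
  · constructor <;> simp +contextual
  · simp +decide only [update_self, update_of_ne, ne_eq]
    by_cases hroot : m₁.fld fPar (m₁.fld fPar x) = m₁.fld fPar x
    · have := F.charge_le_charge_halve hx
      have := F.level_rk_le_level_rk_par_par hx
      rw [if_pos (by rw [hroot, update_of_ne hne, hroot])]
      omega
    · have := F.charge_add_level_lt_halve hx hne hroot
      omega

theorem run_findRoot (F : Forest V (m.fld fPar) (m.fld fRank) rt) (hx : m.reg rNode < V) :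
    Run findRoot m fun t m' => Compressed V rt m m' ∧ m'.reg rNode = rt (m.reg rNode) ∧
      t + 5 * charge V (m.fld fPar) (m.fld fRank) ≤
        5 * charge V (m'.fld fPar) (m'.fld fRank) + 5 * logStar V + 7 := by
  rw [findRoot, run_seq, run_prim]
  refine (run_loop (fun k τ m₁ => Climbing V rt m τ m₁ ∧ k + m₁.fld fRank (m₁.reg rNode) = V)
    ?_ (τ := 0) (k := V - m.fld fRank (m.reg rNode)) ?_).mono ?_
  · rintro k τ m₁ ⟨h, hk⟩ (hb : m₁.reg rPar ≠ m₁.reg rNode)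
    refine (run_halveStep h hb).mono fun t m' ⟨_, h'⟩ => ?_
    have := h'.forest.rk_lt_card h'.node_lt
    exact ⟨V - m'.fld fRank (m'.reg rNode), by omega, h', by omega⟩
  · have := F.rk_lt_card hx
    simp +decide only [Prim.run, update_of_ne, ne_eq]
    refine ⟨⟨⟨F, ?_, rfl, le_rfl⟩, hx, rfl, rfl, ?_⟩, by omega⟩
    · constructor <;> simp +contextual
    · simp only
      omega
  · rintro t m' ⟨k, τ, ⟨h, -⟩, hb, ht⟩
    have hroot : m'.fld fPar (m'.reg rNode) = m'.reg rNode := h.par_eq ▸ not_not.1 hb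
    have hτ := h.time_le
    rw [if_pos hroot] at hτ
    refine ⟨h.toCompressed, h.rt_node ▸ (h.forest.rt_self _ h.node_lt hroot).symm, ?_⟩
    have := h.forest.level_rk_le h.node_lt
    omega

end

/-! ### Tables of half-edges and the queue of pending identifications -/

section

variable {V K : ℕ} {H O O' : ℕ → ℕ → ℕ → Prop} {rt rt' : ℕ → ℕ} {T : ℕ → ℕ → ℕ}
  {qa qb : ℕ → ℕ} {hd tl k v b : ℕ}

/-- After folding, there is a half-edge of type `k` from the class of `a` to the class of `b`. -/
def FoldedHalfEdge (H : ℕ → ℕ → ℕ → Prop) (a k b : ℕ) : Prop :=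
  ∃ a' b', H a' k b' ∧ foldSetoid H a' a ∧ foldSetoid H b' b

theorem FoldedHalfEdge.of_halfEdge {a : ℕ} (h : H a k b) : FoldedHalfEdge H a k b :=
  ⟨a, b, h, Setoid.refl' _ a, Setoid.refl' _ b⟩

theorem FoldedHalfEdge.congr_left {a a' : ℕ} (h : FoldedHalfEdge H a k b)
    (ha : foldSetoid H a a') : FoldedHalfEdge H a' k b := by
  obtain ⟨a₀, b₀, h₀, ha₀, hb₀⟩ := h
  exact ⟨a₀, b₀, h₀, Setoid.trans' _ ha₀ ha, hb₀⟩

theorem FoldedHalfEdge.rel {a b' : ℕ} (h : FoldedHalfEdge H a k b)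
    (h' : FoldedHalfEdge H a k b') : foldSetoid H b b' := by
  obtain ⟨a₀, b₀, h₀, ha₀, hb₀⟩ := h
  obtain ⟨a₁, b₁, h₁, ha₁, hb₁⟩ := h'
  have hab := foldClosed_foldSetoid h₀ h₁ (Setoid.trans' _ ha₀ (Setoid.symm' _ ha₁))
  exact Setoid.trans' _ (Setoid.symm' _ hb₀) (Setoid.trans' _ hab hb₁)

/-- The half-edges in `O` together with a half-edge of type `k` from `v` to `b`. -/
def insertHalfEdge (O : ℕ → ℕ → ℕ → Prop) (v k b : ℕ) : ℕ → ℕ → ℕ → Prop :=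
  fun x j y => O x j y ∨ (x = v ∧ j = k ∧ y = b)

/-- The finest equivalence relation that identifies `v` with `rt v`, and the members of each pair
`(qa i, qb i)` with `hd ≤ i < tl`. -/
def pendingSetoid (V : ℕ) (rt qa qb : ℕ → ℕ) (hd tl : ℕ) : Setoid ℕ :=
  Relation.EqvGen.setoid fun a b =>
    (b < V ∧ rt b = a) ∨ ∃ i, hd ≤ i ∧ i < tl ∧ qa i = a ∧ qb i = b

theorem pendingSetoid_rt (hv : v < V) : pendingSetoid V rt qa qb hd tl (rt v) v :=
  .rel _ _ (.inl ⟨hv, rfl⟩)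

theorem pendingSetoid_pair {i : ℕ} (hi : hd ≤ i) (hi' : i < tl) :
    pendingSetoid V rt qa qb hd tl (qa i) (qb i) :=
  .rel _ _ (.inr ⟨i, hi, hi', rfl, rfl⟩)

theorem pendingSetoid_le {r : Setoid ℕ} (hrt : ∀ v < V, r (rt v) v)
    (hq : ∀ i, hd ≤ i → i < tl → r (qa i) (qb i)) : pendingSetoid V rt qa qb hd tl ≤ r := by
  refine Setoid.eqvGen_le ?_
  rintro a b (⟨hb, rfl⟩ | ⟨i, hi, hi', rfl, rfl⟩)
  exacts [hrt b hb, hq i hi hi']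

/-- The queue holds the pairs `(qa i, qb i)` with `hd ≤ i < tl`, and `T k x` is the target of the
half-edge of type `k` at `x`, where `V` stands for none. All of this is correct after folding `H`.
Conversely, each half-edge in `O` is in the tables up to the identifications already made and
those in the queue. -/
structure Tables (V K : ℕ) (H : ℕ → ℕ → ℕ → Prop) (rt : ℕ → ℕ) (O : ℕ → ℕ → ℕ → Prop)
    (T : ℕ → ℕ → ℕ) (qa qb : ℕ → ℕ) (hd tl : ℕ) : Prop where
  T_le : ∀ k < K, ∀ v < V, T k v ≤ V
  q_lt : ∀ i < tl, qa i < V ∧ qb i < V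
  hd_le : hd ≤ tl
  rt_sound : ∀ v < V, foldSetoid H (rt v) v
  q_sound : ∀ i < tl, foldSetoid H (qa i) (qb i)
  T_sound : ∀ k < K, ∀ v < V, T k v ≠ V → FoldedHalfEdge H v k (T k v)
  complete : ∀ x k b, O x k b → T k x ≠ V ∧ pendingSetoid V rt qa qb hd tl (T k x) b

namespace Tables

theorem mono (h : Tables V K H rt O T qa qb hd tl) (hO : O' ≤ O) :
    Tables V K H rt O' T qa qb hd tl :=
  { h with complete := fun x k b hx => h.complete x k b (hO x k b hx) }

theorem store (h : Tables V K H rt O T qa qb hd tl) (hb : b < V) (hV : T k v = V)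
    (hs : FoldedHalfEdge H v k b) :
    Tables V K H rt (insertHalfEdge O v k b) (update T k (update (T k) v b)) qa qb hd tl := by
  have hT (j x : ℕ) : update T k (update (T k) v b) j x = if j = k ∧ x = v then b else T j x := by
    rcases eq_or_ne j k with rfl | hj
    · simp [update_apply]
    · simp [hj]
  refine { h with T_le := ?_, T_sound := ?_, complete := ?_ } <;> simp only [hT]
  · intro j hj x hx
    split_ifs
    exacts [hb.le, h.T_le j hj x hx]
  · intro j hj x hx
    split_ifs with he
    · exact fun _ => he.1 ▸ he.2 ▸ hs
    · exact h.T_sound j hj x hx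
  · rintro x j y (hx | ⟨rfl, rfl, rfl⟩)
    · have hxj := h.complete x j y hx
      have : ¬(j = k ∧ x = v) := by
        rintro ⟨rfl, rfl⟩
        exact hxj.1 hV
      rwa [if_neg this]
    · rw [if_pos ⟨rfl, rfl⟩]
      exact ⟨hb.ne, Setoid.refl' _ _⟩

theorem push (h : Tables V K H rt O T qa qb hd tl) (hk : k < K) (hv : v < V) (hb : b < V)
    (hV : T k v ≠ V) (hs : FoldedHalfEdge H v k b) :
    Tables V K H rt (insertHalfEdge O v k b) T (update qa tl (T k v)) (update qb tl b)
      hd (tl + 1) := by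
  have hle : pendingSetoid V rt qa qb hd tl ≤
      pendingSetoid V rt (update qa tl (T k v)) (update qb tl b) hd (tl + 1) := by
    refine pendingSetoid_le (fun v => pendingSetoid_rt) fun i hi hi' => ?_
    have := pendingSetoid_pair (V := V) (rt := rt) (qa := update qa tl (T k v))
      (qb := update qb tl b) hi (hi'.trans tl.lt_succ_self)
    rwa [update_of_ne hi'.ne, update_of_ne hi'.ne] at this
  have hnew : pendingSetoid V rt (update qa tl (T k v)) (update qb tl b) hd (tl + 1) (T k v) b := by
    have := pendingSetoid_pair (V := V) (rt := rt) (qa := update qa tl (T k v))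
      (qb := update qb tl b) h.hd_le tl.lt_succ_self
    rwa [update_self, update_self] at this
  refine { h with hd_le := h.hd_le.trans tl.le_succ, q_lt := ?_, q_sound := ?_, complete := ?_ }
  · intro i hi
    rcases Nat.lt_succ_iff_lt_or_eq.1 hi with hi | rfl
    · rw [update_of_ne hi.ne, update_of_ne hi.ne]
      exact h.q_lt i hi
    · rw [update_self, update_self]
      exact ⟨(h.T_le k hk v hv).lt_of_ne hV, hb⟩
  · intro i hi
    rcases Nat.lt_succ_iff_lt_or_eq.1 hi with hi | rfl
    · rw [update_of_ne hi.ne, update_of_ne hi.ne]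
      exact h.q_sound i hi
    · rw [update_self, update_self]
      exact (h.T_sound k hk v hv hV).rel hs
  · rintro x j y (hx | ⟨rfl, rfl, rfl⟩)
    · exact (h.complete x j y hx).imp_right fun hxy => hle hxy
    · exact ⟨hV, hnew⟩

theorem pop (h : Tables V K H rt O T qa qb hd tl) (hlt : hd < tl) (hrt : ∀ v < V, rt v < V)
    (hrt' : ∀ v < V, rt' (rt v) = rt' v) (hq : rt' (qa hd) = rt' (qb hd))
    (hs : ∀ v < V, foldSetoid H (rt' v) v) : Tables V K H rt' O T qa qb (hd + 1) tl := by
  have hker {a b : ℕ} (ha : a < V) (hb : b < V) (hab : rt' a = rt' b) :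
      pendingSetoid V rt' qa qb (hd + 1) tl a b :=
    Setoid.trans' _ (Setoid.symm' _ (pendingSetoid_rt ha)) (hab ▸ pendingSetoid_rt hb)
  have hle : pendingSetoid V rt qa qb hd tl ≤ pendingSetoid V rt' qa qb (hd + 1) tl := by
    refine pendingSetoid_le (fun v hv => hker (hrt v hv) hv (hrt' v hv)) fun i hi hi' => ?_
    rcases hi.eq_or_lt with rfl | hi
    · exact hker (h.q_lt _ hlt).1 (h.q_lt _ hlt).2 hq
    · exact pendingSetoid_pair hi hi'
  exact { h with
    hd_le := hlt
    rt_sound := hs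
    complete := fun x k b hx => (h.complete x k b hx).imp_right fun hxb => hle hxb }

end Tables

end

section

variable {V K k : ℕ} {H O : ℕ → ℕ → ℕ → Prop} {rt : ℕ → ℕ} {m m' : Mem}

/-- The tables and the queue are in memory. -/
structure Mem.HasTables (m : Mem) (V K : ℕ) (H : ℕ → ℕ → ℕ → Prop) (rt : ℕ → ℕ)
    (O : ℕ → ℕ → ℕ → Prop) : Prop where
  verts : m.reg rVerts = V
  tables : Tables V K H rt O (fun k => m.fld (k + fTable)) (m.fld fFst) (m.fld fSnd)
    (m.reg rHead) (m.reg rTail)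

theorem Mem.HasTables.mono {O' : ℕ → ℕ → ℕ → Prop} (h : m.HasTables V K H rt O) (hO : O' ≤ O) :
    m.HasTables V K H rt O' :=
  ⟨h.verts, h.tables.mono hO⟩

theorem Mem.HasTables.of_eqOff {R F : Set ℕ} (h : m.HasTables V K H rt O) (hE : m.EqOff R F m')
    (hR : rVerts ∉ R ∧ rHead ∉ R ∧ rTail ∉ R := by simp)
    (hF : fFst ∉ F ∧ fSnd ∉ F ∧ ∀ k, k + fTable ∉ F := by simp) : m'.HasTables V K H rt O := by
  refine ⟨(hE.reg _ hR.1).trans h.verts, ?_⟩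
  simp only [hE.reg _ hR.2.1, hE.reg _ hR.2.2, hE.fld _ hF.1, hE.fld _ hF.2.1,
    fun k => hE.fld _ (hF.2.2 k)]
  exact h.tables

/-- Record a half-edge of type `k` from the vertex in `rSrc` to the vertex in `rTgt`. -/
def putHalfEdge (k : ℕ) : Prog :=
  .load rOld (k + fTable) rSrc ;;
  .ite (.eq rOld rVerts) (.store (k + fTable) rSrc rTgt)
    (.store fFst rTail rOld ;; .store fSnd rTail rTgt ;; .succ rTail)

theorem run_putHalfEdge (h : m.HasTables V K H rt O) (hk : k < K) (hv : m.reg rSrc < V)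
    (hb : m.reg rTgt < V) (hs : FoldedHalfEdge H (m.reg rSrc) k (m.reg rTgt)) :
    Run (putHalfEdge k) m fun t m' =>
      m'.HasTables V K H rt (insertHalfEdge O (m.reg rSrc) k (m.reg rTgt)) ∧
      m'.reg rTail ≤ m.reg rTail + 1 ∧
      (∀ j x, x ≠ m.reg rSrc → m'.fld (j + fTable) x = m.fld (j + fTable) x) ∧
      m.EqOff {rOld, rTail} ({fFst, fSnd} ∪ Set.Ici fTable) m' ∧ t ≤ 5 := by
  simp +decide only [putHalfEdge, run_seq, run_ite, run_prim, Prim.run, Test.Holds, update_self,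
    update_of_ne, ne_eq, h.verts]
  constructor
  · intro hV
    refine ⟨⟨h.verts, ?_⟩, Nat.le_succ _, fun j x hx => ?_, ?_, by simp⟩
    · convert h.tables.store hb hV hs using 1
      · exact update_comp_eq_of_injective m.fld (add_left_injective _) k _
      all_goals simp
    · rcases eq_or_ne j k with rfl | hj
      · simp [hx]
      · simp [hj]
    · refine Mem.EqOff.update_fld (m' := { m with reg := update m.reg rOld _ }) ?_ (by simp)
      constructor <;> simp +contextual
  · intro hV
    refine ⟨⟨h.verts, ?_⟩, le_rfl, fun _ _ _ => ?_, ?_, by simp⟩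
    · have := h.tables.push hk hv hb hV hs
      simpa using this
    · simp
    · constructor <;> simp +contextual

end

/-! ### Setting up the forest and the tables -/

section

variable {V E n K : ℕ} {H O : ℕ → ℕ → ℕ → Prop} {rt : ℕ → ℕ} {m : Mem}

/-- Make the vertex in `rIdx` a tree of its own, with no half-edges. -/
def setUpVertex (K : ℕ) : Prog :=
  .store fPar rIdx rIdx ;; .store fRank rIdx rZero ;;
    unroll (fun k => .store (k + fTable) rIdx rVerts) K

/-- Make every vertex a tree of its own, with no half-edges, and the queue empty. -/
def setUp (K : ℕ) : Prog :=
  .const rZero 0 ;; .const rHead 0 ;; .const rTail 0 ;; forLoop rIdx rVerts (setUpVertex K)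

/-- The vertex `v` is a tree of its own, with no half-edges. -/
def Mem.IsFresh (m : Mem) (V K v : ℕ) : Prop :=
  m.fld fPar v = v ∧ m.fld fRank v = 0 ∧ ∀ k < K, m.fld (k + fTable) v = V

theorem run_setUpVertex (hz : m.reg rZero = 0) :
    Run (setUpVertex K) m fun t m' => m.EqOff ∅ ({fPar, fRank} ∪ Set.Ici fTable) m' ∧
      m'.IsFresh (m.reg rVerts) K (m.reg rIdx) ∧
      (∀ f, ∀ v ≠ m.reg rIdx, m'.fld f v = m.fld f v) ∧ t ≤ K + 3 := by
  simp +decide only [setUpVertex, run_seq, run_prim, Prim.run, hz]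
  refine (run_unroll (R := ∅) (F := Set.Ici fTable) (fun k τ m' =>
    (∀ j < k, m'.fld (j + fTable) (m.reg rIdx) = m.reg rVerts) ∧
    (∀ f, ∀ v ≠ m.reg rIdx, m'.fld f v = m.fld f v) ∧ k = τ) ?_ ?_).mono ?_
  · rintro k - _ m₁ hE ⟨hk, hv, rfl⟩
    rw [run_prim]
    simp only [Prim.run, hE.reg _ (Set.notMem_empty _), and_true]
    refine ⟨(Mem.EqOff.refl _ _ m₁).update_fld (by simp), fun j hj => ?_, fun f v hne => ?_⟩
    · rcases Nat.lt_succ_iff_lt_or_eq.1 hj with hj | rfl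
      · simp [hj.ne, hk j hj]
      · simp
    · by_cases hf : f = k + fTable
      · simp [hf, hne, hv]
      · simp [hf, hv f v hne]
  · refine ⟨by simp, fun f v hne => ?_, rfl⟩
    simp only [update_apply]
    split_ifs <;> simp_all
  · rintro t m' ⟨hE, _, ⟨hT, hv, rfl⟩, rfl⟩
    refine ⟨⟨hE.reg, fun f hf => ?_⟩, ⟨?_, ?_, hT⟩, hv, by omega⟩
    · simp only [Set.mem_union, Set.mem_insert_iff, Set.mem_singleton_iff, not_or] at hf
      exact (hE.fld f hf.2).trans ((update_of_ne hf.1.2 _ _).trans (update_of_ne hf.1.1 _ _))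
    · rw [hE.fld _ (by simp)]
      simp
    · rw [hE.fld _ (by simp)]
      simp

theorem run_setUp (K : ℕ) (m : Mem) :
    Run (setUp K) m fun t m' =>
      m.EqOff {rIdx, rZero, rHead, rTail} ({fPar, fRank} ∪ Set.Ici fTable) m' ∧
      m'.reg rHead = 0 ∧ m'.reg rTail = 0 ∧ m'.reg rZero = 0 ∧
      (∀ v < m.reg rVerts, m'.IsFresh (m.reg rVerts) K v) ∧ t ≤ (K + 5) * m.reg rVerts + 5 := by
  simp +decide only [setUp, run_seq, run_prim, Prim.run]
  refine (run_forLoop (R := ∅) (F := {fPar, fRank} ∪ Set.Ici fTable) (fun j τ m' =>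
    (∀ v < j, m'.IsFresh (m.reg rVerts) K v) ∧ τ ≤ (K + 5) * j) ?_ ?_).mono ?_
  · rintro j hj τ m₁ hE rfl ⟨hF, hτ⟩
    have hV : m₁.reg rVerts = m.reg rVerts := by
      rw [hE.reg _ (by simp)]
      simp
    have hz : m₁.reg rZero = 0 := by
      rw [hE.reg _ (by simp)]
      simp
    refine (run_setUpVertex hz).mono ?_
    rintro t m' ⟨hE', hj', hv, ht⟩
    refine ⟨hE', fun v hv' => ?_, ?_⟩
    · rcases Nat.lt_succ_iff_lt_or_eq.1 hv' with hv' | rfl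
      · simpa only [Mem.IsFresh, hv _ v hv'.ne] using hF v hv'
      · exact hV ▸ hj'
    · rw [mul_add]
      omega
  · simp
  · rintro t m' ⟨hE, τ, ⟨hF, hτ⟩, rfl⟩
    simp +decide only [update_of_ne, ne_eq] at hF hτ
    refine ⟨⟨fun r hr => ?_, hE.fld⟩, ?_, ?_, ?_, hF, by omega⟩
    · rw [hE.reg r (by simp_all)]
      simp_all
    all_goals
      rw [hE.reg _ (by simp)]
      simp

theorem Mem.hasTables_of_isFresh (hV : m.reg rVerts = V) (hh : m.reg rHead = 0)
    (ht : m.reg rTail = 0) (hF : ∀ v < V, m.IsFresh V K v) :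
    m.HasTables V K H (fun x => x) ⊥ := by
  refine ⟨hV, ?_⟩
  rw [hh, ht]
  exact
    { T_le := fun k hk v hv => ((hF v hv).2.2 k hk).le
      q_lt := by simp
      hd_le := le_rfl
      rt_sound := fun v _ => Setoid.refl' _ v
      q_sound := by simp
      T_sound := fun k hk v hv h => absurd ((hF v hv).2.2 k hk) h
      complete := fun _ _ _ h => h.elim }

/-! ### Entering the edges -/

/-- The instruction that exchanges the values of `r` and `s`. -/
def swap (r s : ℕ) : Prog :=
  .copy rTmp r ;; .copy r s ;; .copy s rTmp

theorem run_swap {r s : ℕ} {Q : ℕ → Mem → Prop} (hr : r ≠ rTmp) (hs : s ≠ rTmp) :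
    Run (swap r s) m Q ↔
      Q 3 { m with
        reg := update (update (update m.reg rTmp (m.reg r)) r (m.reg s)) s (m.reg r) } := by
  simp only [swap, run_seq, run_prim, Prim.run, update_self, update_of_ne hs, update_of_ne hr.symm]

/-- The half-edges of the graph with edges `0, …, E - 1`: an edge from `a` to `b` with label `k`
yields a half-edge of type `k` from `a` to `b`, and one of type `k + n` from `b` to `a`. -/
def halfEdge (n : ℕ) (ini ter lab : ℕ → ℕ) (E a k b : ℕ) : Prop :=
  ∃ e < E, (a = ini e ∧ k = lab e ∧ b = ter e) ∨ (a = ter e ∧ k = lab e + n ∧ b = ini e)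

theorem halfEdge_zero (n : ℕ) (ini ter lab : ℕ → ℕ) : halfEdge n ini ter lab 0 = ⊥ := by
  funext a k b
  simp [halfEdge]

theorem halfEdge_succ_le {n : ℕ} {ini ter lab : ℕ → ℕ} {e : ℕ} :
    halfEdge n ini ter lab (e + 1) ≤
      insertHalfEdge (insertHalfEdge (halfEdge n ini ter lab e) (ini e) (lab e) (ter e))
        (ter e) (lab e + n) (ini e) := by
  rintro a k b ⟨e', he', h⟩
  rcases Nat.lt_succ_iff_lt_or_eq.1 he' with he' | rfl
  · exact .inl (.inl ⟨e', he', h⟩)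
  · exact h.elim (fun h => .inl (.inr h)) .inr

/-- Enter an edge with label `k` into the tables, where `rSrc` and `rTgt` are its ends. -/
def enterEdge (n k : ℕ) : Prog :=
  putHalfEdge k ;; swap rSrc rTgt ;; putHalfEdge (k + n)

/-- Enter the edge in `rIdx` into the tables. -/
def enterIndexedEdge (n : ℕ) : Prog :=
  .load rSrc fIni rIdx ;; .load rTgt fTer rIdx ;; .load rLab fLab rIdx ;;
    dispatch rLab rCase (enterEdge n) n

/-- Enter the edges into the tables. -/
def enterEdges (n : ℕ) : Prog :=
  forLoop rIdx rEdges (enterIndexedEdge n)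

theorem run_enterEdge (h : m.HasTables V (2 * n) H rt O) {k : ℕ} (hk : k < n)
    (hv : m.reg rSrc < V) (hb : m.reg rTgt < V) (hs : H (m.reg rSrc) k (m.reg rTgt))
    (hs' : H (m.reg rTgt) (k + n) (m.reg rSrc)) :
    Run (enterEdge n k) m fun t m' =>
      m'.HasTables V (2 * n) H rt (insertHalfEdge (insertHalfEdge O
        (m.reg rSrc) k (m.reg rTgt)) (m.reg rTgt) (k + n) (m.reg rSrc)) ∧
      m'.reg rTail ≤ m.reg rTail + 2 ∧
      m.EqOff {rSrc, rTgt, rOld, rTmp, rTail} ({fFst, fSnd} ∪ Set.Ici fTable) m' ∧ t ≤ 13 := by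
  rw [enterEdge, run_seq]
  refine (run_putHalfEdge h (by omega) hv hb (.of_halfEdge hs)).mono ?_
  rintro t₁ m₁ ⟨h₁, htail₁, -, hE₁, ht₁⟩
  have hsrc := hE₁.reg rSrc (by simp)
  have htgt := hE₁.reg rTgt (by simp)
  rw [run_seq, run_swap (by simp) (by simp), hsrc, htgt]
  generalize hm₂ : { m₁ with reg := _ } = m₂
  have hE₂ : m₁.EqOff {rSrc, rTgt, rTmp} ∅ m₂ := by
    subst hm₂
    constructor <;> simp +contextual
  have hsrc₂ : m₂.reg rSrc = m.reg rTgt := by simp [← hm₂]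
  have htgt₂ : m₂.reg rTgt = m.reg rSrc := by simp [← hm₂]
  rw [← hsrc₂, ← htgt₂] at h₁ hs' ⊢
  rw [← hsrc₂] at hb
  rw [← htgt₂] at hv
  refine (run_putHalfEdge (h₁.of_eqOff hE₂) (by omega) hb hv (.of_halfEdge hs')).mono ?_
  rintro t₃ m₃ ⟨h₃, htail₃, -, hE₃, ht₃⟩
  rw [hE₂.reg rTail (by simp)] at htail₃
  exact ⟨h₃, by omega, ((hE₁.trans hE₂).trans hE₃).mono, by omega⟩

theorem run_enterIndexedEdge {ini ter lab : ℕ → ℕ} {e : ℕ} (hini : m.fld fIni = ini)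
    (hter : m.fld fTer = ter) (hlab : m.fld fLab = lab) (he : m.reg rIdx = e)
    (h : m.HasTables V (2 * n) H rt O) (hk : lab e < n) (hv : ini e < V) (hb : ter e < V)
    (hs : H (ini e) (lab e) (ter e)) (hs' : H (ter e) (lab e + n) (ini e)) :
    Run (enterIndexedEdge n) m fun t m' =>
      m'.HasTables V (2 * n) H rt (insertHalfEdge (insertHalfEdge O
        (ini e) (lab e) (ter e)) (ter e) (lab e + n) (ini e)) ∧
      m'.reg rTail ≤ m.reg rTail + 2 ∧
      m.EqOff {rSrc, rTgt, rLab, rCase, rOld, rTmp, rTail} ({fFst, fSnd} ∪ Set.Ici fTable) m' ∧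
      t ≤ 2 * n + 16 := by
  simp +decide only [enterIndexedEdge, run_seq, run_prim, Prim.run, update_of_ne, ne_eq, hini, hter,
    hlab, he]
  generalize hm₁ : ({ m with reg := _ } : Mem) = m₁
  have hlab₁ : m₁.reg rLab = lab e := by simp [← hm₁]
  generalize hm₂ : ({ m₁ with reg := update m₁.reg rCase (lab e) } : Mem) = m₂
  have hE₂ : m.EqOff {rSrc, rTgt, rLab, rCase} ∅ m₂ := by
    subst hm₂ hm₁
    constructor <;> simp +contextual
  have hsrc : m₂.reg rSrc = ini e := by simp [← hm₂, ← hm₁]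
  have htgt : m₂.reg rTgt = ter e := by simp [← hm₂, ← hm₁]
  have henter := run_enterEdge (h.of_eqOff hE₂) hk (hsrc ▸ hv) (htgt ▸ hb)
    (by rwa [hsrc, htgt]) (by rwa [hsrc, htgt])
  rw [← hm₂, ← hlab₁] at henter
  refine (run_dispatch (by simp) (hlab₁ ▸ hk) henter).mono ?_
  rw [hlab₁, hm₂, hsrc, htgt, hE₂.reg rTail (by simp)]
  rintro t m' ⟨t', ⟨h', htail', hE', ht'⟩, ht⟩
  exact ⟨h', htail', (hE₂.trans hE').mono, by omega⟩

theorem run_enterEdges (hini : ∀ e < E, m.fld fIni e < V) (hter : ∀ e < E, m.fld fTer e < V)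
    (hlab : ∀ e < E, m.fld fLab e < n) (hE : m.reg rEdges = E) (htail : m.reg rTail = 0)
    (h : m.HasTables V (2 * n) (halfEdge n (m.fld fIni) (m.fld fTer) (m.fld fLab) E) rt ⊥) :
    Run (enterEdges n) m fun t m' =>
      m'.HasTables V (2 * n) (halfEdge n (m.fld fIni) (m.fld fTer) (m.fld fLab) E) rt
        (halfEdge n (m.fld fIni) (m.fld fTer) (m.fld fLab) E) ∧
      m'.reg rTail ≤ 2 * E ∧
      m.EqOff {rIdx, rSrc, rTgt, rLab, rCase, rOld, rTmp, rTail}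
        ({fFst, fSnd} ∪ Set.Ici fTable) m' ∧
      t ≤ (2 * n + 18) * E + 2 := by
  set H := halfEdge n (m.fld fIni) (m.fld fTer) (m.fld fLab) with hH
  refine (run_forLoop (R := {rSrc, rTgt, rLab, rCase, rOld, rTmp, rTail})
    (F := {fFst, fSnd} ∪ Set.Ici fTable) (fun e τ m' => m'.HasTables V (2 * n) (H E) rt (H e) ∧
      m'.reg rTail ≤ 2 * e ∧ τ ≤ (2 * n + 18) * e) ?_ ?_).mono ?_
  · rintro e he τ m₁ hE₁ hidx ⟨h₁, htail₁, hτ⟩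
    rw [hE] at he
    refine (run_enterIndexedEdge (hE₁.fld _ (by simp)) (hE₁.fld _ (by simp)) (hE₁.fld _ (by simp))
      hidx h₁ (hlab e he) (hini e he) (hter e he) ⟨e, he, .inl ⟨rfl, rfl, rfl⟩⟩
      ⟨e, he, .inr ⟨rfl, rfl, rfl⟩⟩).mono ?_
    rintro t m' ⟨h', htail', hE', ht⟩
    refine ⟨hE', (h'.mono halfEdge_succ_le).of_eqOff (R := {rIdx}) (F := ∅) ?_, ?_, ?_⟩
    · constructor <;> simp +contextual
    · simp +decide only [update_of_ne, ne_eq]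
      omega
    · rw [mul_add]
      omega
  · refine ⟨?_, by simp [htail], by simp⟩
    rw [hH, halfEdge_zero]
    refine h.of_eqOff (R := {rIdx}) (F := ∅) ?_
    constructor <;> simp +contextual
  · rintro t m' ⟨hE', τ, ⟨h', htail', hτ⟩, rfl⟩
    rw [hE] at h' htail' hτ
    exact ⟨h', htail', hE', by omega⟩

end

/-! ### Processing the queue -/

section

variable {V K k u w : ℕ} {H O : ℕ → ℕ → ℕ → Prop} {rt : ℕ → ℕ} {m : Mem}

/-- Given the distinct roots `rRoot` and `rNode`, exchange them if necessary, or increase the rank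
of `rNode`, so that the rank of `rRoot` is less than the rank of `rNode`. -/
def orderRoots : Prog :=
  .load rRankLeft fRank rRoot ;; .load rRankRight fRank rNode ;;
    .ite (.lt rRankLeft rRankRight) (.prim .skip)
      (.ite (.lt rRankRight rRankLeft) (swap rRoot rNode)
        (.succ rRankRight ;; .store fRank rNode rRankRight))

/-- Link the trees with the roots `rRoot` and `rNode`. Afterwards, `rNode` is the root. -/
def linkRoots : Prog :=
  orderRoots ;; .store fPar rRoot rNode

theorem run_orderRoots (hu : m.reg rRoot < V) (hw : m.reg rNode < V)
    (hne : m.reg rRoot ≠ m.reg rNode) (hpu : m.fld fPar (m.reg rRoot) = m.reg rRoot)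
    (hpw : m.fld fPar (m.reg rNode) = m.reg rNode) :
    Run orderRoots m fun t m' =>
      s(m'.reg rRoot, m'.reg rNode) = s(m.reg rRoot, m.reg rNode) ∧
      (∃ r, Forest.Linkable V (m.fld fPar) (m.fld fRank) (m'.reg rRoot) (m'.reg rNode) r ∧
        m'.fld fRank = update (m.fld fRank) (m'.reg rNode) r) ∧
      m.EqOff {rRoot, rNode, rRankLeft, rRankRight, rTmp} {fRank} m' ∧ t ≤ 7 := by
  have hswap {m : Mem} {Q} : Run (swap rRoot rNode) m Q ↔ _ := run_swap (by simp) (by simp)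
  simp +decide only [orderRoots, run_seq, run_ite, run_prim, hswap, Prim.run, Test.Holds,
    update_self, update_of_ne, ne_eq]
  refine ⟨fun hlt => ?_, fun hge => ⟨fun hlt => ?_, fun hle => ?_⟩⟩
  · refine ⟨trivial, ⟨_, ⟨hu, hw, hne, hpu, hpw, .inl ⟨rfl, hlt⟩⟩, (update_eq_self _ _).symm⟩, ?_,
      by simp⟩
    constructor <;> simp +contextual
  · refine ⟨Sym2.eq_swap, ⟨_, ⟨hw, hu, hne.symm, hpw, hpu, .inl ⟨rfl, hlt⟩⟩,
      (update_eq_self _ _).symm⟩, ?_, by simp⟩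
    constructor <;> simp +contextual
  · refine ⟨trivial, ⟨_, ⟨hu, hw, hne, hpu, hpw, .inr ⟨rfl, by omega⟩⟩, rfl⟩, ?_, by simp⟩
    constructor <;> simp +contextual

theorem run_linkRoots (F : Forest V (m.fld fPar) (m.fld fRank) rt) (hu : m.reg rRoot < V)
    (hw : m.reg rNode < V) (hne : m.reg rRoot ≠ m.reg rNode)
    (hpu : m.fld fPar (m.reg rRoot) = m.reg rRoot)
    (hpw : m.fld fPar (m.reg rNode) = m.reg rNode) :
    Run linkRoots m fun t m' =>
      s(m'.reg rRoot, m'.reg rNode) = s(m.reg rRoot, m.reg rNode) ∧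
      Forest V (m'.fld fPar) (m'.fld fRank)
        (fun x => if rt x = m'.reg rRoot then m'.reg rNode else rt x) ∧
      charge V (m.fld fPar) (m.fld fRank) ≤ charge V (m'.fld fPar) (m'.fld fRank) ∧
      numRoots V (m'.fld fPar) < numRoots V (m.fld fPar) ∧
      m.EqOff {rRoot, rNode, rRankLeft, rRankRight, rTmp} {fPar, fRank} m' ∧ t ≤ 8 := by
  rw [linkRoots, run_seq]
  refine (run_orderRoots hu hw hne hpu hpw).mono ?_
  rintro t m₁ ⟨huw, ⟨r, L, hrk⟩, hE, ht⟩
  have hpar : m₁.fld fPar = m.fld fPar := hE.fld _ (by simp)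
  rw [run_prim]
  simp +decide only [Prim.run, update_self, update_of_ne, ne_eq, hpar, hrk]
  refine ⟨huw, F.link L, L.charge_le_charge, L.numRoots_lt, ?_, by omega⟩
  exact hE.mono.update_fld (by simp)

/-- The half-edges of `H`, moved to the roots of their initial vertices. -/
def halfEdgesAtRoots (H : ℕ → ℕ → ℕ → Prop) (rt : ℕ → ℕ) (x k b : ℕ) : Prop :=
  ∃ a, H a k b ∧ rt a = x

/-- For each `j < k`, the half-edge of type `j` from `w` to `f j`, where `f j = V` stands for none.
It is there because of the half-edge from `u` to `f j` when `u` has been linked to `w`. -/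
def movedHalfEdges (V k : ℕ) (f : ℕ → ℕ) (w x j y : ℕ) : Prop :=
  x = w ∧ j < k ∧ y = f j ∧ y ≠ V

theorem sup_movedHalfEdges_succ_le (O : ℕ → ℕ → ℕ → Prop) (V k : ℕ) (f : ℕ → ℕ) (w : ℕ) :
    O ⊔ movedHalfEdges V (k + 1) f w ≤ fun x j y =>
      (O ⊔ movedHalfEdges V k f w) x j y ∨ x = w ∧ j = k ∧ y = f k ∧ y ≠ V := by
  rintro x j y (hO | ⟨rfl, hj, rfl, hy⟩)
  · exact .inl (.inl hO)
  · rcases Nat.lt_succ_iff_lt_or_eq.1 hj with hj | rfl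
    exacts [.inl (.inr ⟨rfl, hj, rfl, hy⟩), .inr ⟨rfl, rfl, rfl, hy⟩]

theorem halfEdgesAtRoots_of_moved {T : ℕ → ℕ → ℕ} {qa qb rt' : ℕ → ℕ} {hd tl : ℕ}
    (h : Tables V K H rt' (halfEdgesAtRoots H rt ⊔ movedHalfEdges V K (fun k => T k u) w)
      T qa qb hd tl)
    (hH : ∀ a k b, H a k b → k < K) (hrt' : ∀ x, rt' x = if rt x = u then w else rt x) :
    Tables V K H rt' (halfEdgesAtRoots H rt') T qa qb hd tl := by
  refine { h with complete := ?_ }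
  rintro _ k b ⟨a, hab, rfl⟩
  obtain ⟨hne, hb⟩ := h.complete _ k b (.inl ⟨a, hab, rfl⟩)
  rw [hrt']
  split_ifs with hu
  · rw [hu] at hne hb
    obtain ⟨hne', hb'⟩ := h.complete w k (T k u) (.inr ⟨rfl, hH a k b hab, rfl, hne⟩)
    exact ⟨hne', Setoid.trans' _ hb' hb⟩
  · exact ⟨hne, hb⟩

/-- Move the half-edge of type `k` at `rRoot` to `rSrc`. -/
def moveHalfEdge (k : ℕ) : Prog :=
  .load rTgt (k + fTable) rRoot ;; .ite (.eq rTgt rVerts) (.prim .skip) (putHalfEdge k)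

/-- Move the half-edges at `rRoot` to `rSrc`. -/
def moveHalfEdges (K : ℕ) : Prog :=
  unroll moveHalfEdge K

theorem run_moveHalfEdge {f : ℕ → ℕ} (hu : m.reg rRoot = u) (hw : m.reg rSrc = w)
    (hf : ∀ j, m.fld (j + fTable) u = f j)
    (h : m.HasTables V K H rt (O ⊔ movedHalfEdges V k f w)) (hk : k < K) (huV : u < V)
    (hwV : w < V) (hne : u ≠ w) (hs : foldSetoid H u w) :
    Run (moveHalfEdge k) m fun t m' =>
      m'.HasTables V K H rt (O ⊔ movedHalfEdges V (k + 1) f w) ∧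
      m'.reg rTail ≤ m.reg rTail + 1 ∧ (∀ j, m'.fld (j + fTable) u = f j) ∧
      m.EqOff {rTgt, rOld, rTail} ({fFst, fSnd} ∪ Set.Ici fTable) m' ∧ t ≤ 7 := by
  have hO := sup_movedHalfEdges_succ_le O V k f w
  rw [moveHalfEdge, run_seq, run_prim, Prim.run, hu, hf]
  generalize hm₁ : ({ m with reg := _ } : Mem) = m₁
  have hE₁ : m.EqOff {rTgt} ∅ m₁ := by
    subst hm₁
    constructor <;> simp +contextual
  have hsrc : m₁.reg rSrc = w := (hE₁.reg _ (by simp)).trans hw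
  have htail : m₁.reg rTail = m.reg rTail := hE₁.reg _ (by simp)
  have htgt : m₁.reg rTgt = f k := by simp [← hm₁]
  have hf₁ (j : ℕ) : m₁.fld (j + fTable) u = f j := hE₁.fld (j + fTable) (by simp) ▸ hf j
  have h₁ := h.of_eqOff hE₁
  rw [run_ite, run_prim]
  simp only [Test.Holds, htgt, h₁.verts, Prim.run]
  constructor
  · intro hV
    refine ⟨(h₁.mono ?_), by omega, hf₁, hE₁.mono, by simp⟩
    refine hO.trans ?_
    rintro x j y (hxy | ⟨-, -, rfl, hy⟩)
    exacts [hxy, absurd hV hy]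
  · intro hV
    have hfk := h.tables.T_sound k hk u huV (hf k ▸ hV)
    have hfV := (h.tables.T_le k hk u huV).lt_of_ne (hf k ▸ hV)
    rw [hf k] at hfk hfV
    rw [← hsrc] at hwV hs
    rw [← htgt] at hfV hfk
    refine (run_putHalfEdge h₁ hk hwV hfV (hfk.congr_left hs)).mono ?_
    rw [hsrc, htgt]
    rintro t m' ⟨h', htail', hrows, hE', ht⟩
    refine ⟨h'.mono (hO.trans ?_), by omega, fun j => (hrows j u hne).trans (hf₁ j),
      (hE₁.trans hE').mono, by omega⟩
    rintro x j y (hxy | ⟨rfl, rfl, rfl, -⟩)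
    exacts [.inl hxy, .inr ⟨rfl, rfl, rfl⟩]

theorem run_moveHalfEdges (hu : m.reg rRoot = u) (hw : m.reg rSrc = w)
    (h : m.HasTables V K H rt O) (huV : u < V) (hwV : w < V) (hne : u ≠ w)
    (hs : foldSetoid H u w) :
    Run (moveHalfEdges K) m fun t m' =>
      m'.HasTables V K H rt (O ⊔ movedHalfEdges V K (fun k => m'.fld (k + fTable) u) w) ∧
      m'.reg rTail ≤ m.reg rTail + K ∧
      m.EqOff {rTgt, rOld, rTail} ({fFst, fSnd} ∪ Set.Ici fTable) m' ∧ t ≤ 7 * K + 1 := by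
  rw [moveHalfEdges]
  refine (run_unroll (R := {rTgt, rOld, rTail}) (F := {fFst, fSnd} ∪ Set.Ici fTable)
    (fun k τ m' =>
      m'.HasTables V K H rt (O ⊔ movedHalfEdges V k (fun k => m.fld (k + fTable) u) w) ∧
      m'.reg rTail ≤ m.reg rTail + k ∧
      (∀ j, m'.fld (j + fTable) u = m.fld (j + fTable) u) ∧ τ ≤ 7 * k) ?_ ?_).mono ?_
  · rintro k hk τ m₁ hE ⟨h₁, htail, hrows, hτ⟩
    refine (run_moveHalfEdge ((hE.reg _ (by simp)).trans hu) ((hE.reg _ (by simp)).trans hw)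
      hrows h₁ hk huV hwV hne hs).mono ?_
    rintro t m' ⟨h', htail', hrows', hE', ht⟩
    exact ⟨hE', h', by omega, hrows', by omega⟩
  · refine ⟨h.mono ?_, le_rfl, fun _ => rfl, le_rfl⟩
    rintro x j y (hO | ⟨-, hj, -⟩)
    exacts [hO, absurd hj (Nat.not_lt_zero _)]
  · rintro t m' ⟨hE, τ, ⟨h', htail, hrows, hτ⟩, rfl⟩
    exact ⟨by simpa only [hrows] using h', htail, hE, by omega⟩

/-- The forest, the tables and the queue are in memory. The queue and the tables account for all
half-edges. -/
structure Mem.Stage (m : Mem) (V K : ℕ) (H : ℕ → ℕ → ℕ → Prop) (rt : ℕ → ℕ) : Prop where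
  forest : Forest V (m.fld fPar) (m.fld fRank) rt
  hasTables : m.HasTables V K H rt (halfEdgesAtRoots H rt)

theorem Tables.foldSetoid_of_pair {T : ℕ → ℕ → ℕ} {qa qb : ℕ → ℕ} {hd tl : ℕ}
    (h : Tables V K H rt O T qa qb hd tl) (hlt : hd < tl) :
    foldSetoid H (rt (qa hd)) (rt (qb hd)) :=
  Setoid.trans' _ (h.rt_sound _ (h.q_lt hd hlt).1)
    (Setoid.trans' _ (h.q_sound hd hlt) (Setoid.symm' _ (h.rt_sound _ (h.q_lt hd hlt).2)))

theorem Tables.pop_link {T : ℕ → ℕ → ℕ} {qa qb par rk : ℕ → ℕ} {hd tl : ℕ}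
    (h : Tables V K H rt O T qa qb hd tl) (F : Forest V par rk rt) (hlt : hd < tl)
    (huw : s(u, w) = s(rt (qa hd), rt (qb hd))) :
    Tables V K H (fun x => if rt x = u then w else rt x) O T qa qb (hd + 1) tl := by
  have hs : foldSetoid H w u := by
    have := h.foldSetoid_of_pair hlt
    rcases Sym2.eq_iff.1 huw with ⟨rfl, rfl⟩ | ⟨rfl, rfl⟩
    exacts [Setoid.symm' _ this, this]
  refine h.pop hlt F.rt_lt (fun v hv => by simp only [F.rt_rt hv]) ?_ fun v hv => ?_
  · rcases Sym2.eq_iff.1 huw with ⟨rfl, rfl⟩ | ⟨rfl, rfl⟩ <;> simp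
  · split_ifs with hv'
    · exact Setoid.trans' _ hs (hv' ▸ h.rt_sound v hv)
    · exact h.rt_sound v hv

/-- Load the first pair of the queue, remove it, and replace its members by their roots. -/
def findPairRoots : Prog :=
  .load rNode fFst rHead ;; .load rSnd fSnd rHead ;; .succ rHead ;;
    findRoot ;; .copy rRoot rNode ;; .copy rNode rSnd ;; findRoot

theorem run_findPairRoots (F : Forest V (m.fld fPar) (m.fld fRank) rt)
    (ha : m.fld fFst (m.reg rHead) < V) (hb : m.fld fSnd (m.reg rHead) < V) :
    Run findPairRoots m fun t m' =>
      m'.reg rRoot = rt (m.fld fFst (m.reg rHead)) ∧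
      m'.reg rNode = rt (m.fld fSnd (m.reg rHead)) ∧ m'.reg rHead = m.reg rHead + 1 ∧
      Forest V (m'.fld fPar) (m'.fld fRank) rt ∧
      numRoots V (m'.fld fPar) = numRoots V (m.fld fPar) ∧
      m.EqOff {rHead, rNode, rSnd, rPar, rRoot} {fPar} m' ∧
      t + 5 * charge V (m.fld fPar) (m.fld fRank) ≤
        5 * charge V (m'.fld fPar) (m'.fld fRank) + 10 * logStar V + 19 := by
  simp +decide only [findPairRoots, run_seq, run_prim, Prim.run, update_of_ne, ne_eq]
  generalize hm₁ : ({ m with reg := _ } : Mem) = m₁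
  have hE₁ : m.EqOff {rHead, rNode, rSnd} ∅ m₁ := by
    subst hm₁
    constructor <;> simp +contextual
  have hhead : m₁.reg rHead = m.reg rHead + 1 := by simp [← hm₁]
  have hnode : m₁.reg rNode = m.fld fFst (m.reg rHead) := by simp [← hm₁]
  have hsnd : m₁.reg rSnd = m.fld fSnd (m.reg rHead) := by simp [← hm₁]
  rw [← hE₁.fld fPar (by simp), ← hE₁.fld fRank (by simp)] at F ⊢
  refine (run_findRoot F (hnode ▸ ha)).mono ?_
  rintro t₂ m₂ ⟨h₂, hroot, ht₂⟩
  rw [h₂.eqOff.reg rSnd (by simp), hsnd]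
  generalize hm₃ : ({ m₂ with reg := _ } : Mem) = m₃
  have hE₃ : m₂.EqOff {rRoot, rNode} ∅ m₃ := by
    subst hm₃
    constructor <;> simp +contextual
  have hroot₃ : m₃.reg rRoot = rt (m.fld fFst (m.reg rHead)) := by simp [← hm₃, hroot, hnode]
  have hnode₃ : m₃.reg rNode = m.fld fSnd (m.reg rHead) := by simp [← hm₃]
  have F₃ := h₂.forest
  have hnum := h₂.numRoots_eq
  have hch := h₂.charge_le
  rw [← hE₃.fld fPar (by simp), ← hE₃.fld fRank (by simp)] at F₃ ht₂ hch
  rw [← hE₃.fld fPar (by simp)] at hnum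
  refine (run_findRoot F₃ (hnode₃ ▸ hb)).mono ?_
  rintro t₄ m₄ ⟨h₄, hroot₄, ht₄⟩
  refine ⟨(h₄.eqOff.reg _ (by simp)).trans hroot₃, hroot₄.trans (hnode₃ ▸ rfl), ?_, h₄.forest,
    h₄.numRoots_eq.trans hnum, (((hE₁.trans h₂.eqOff).trans hE₃).trans h₄.eqOff).mono, by omega⟩
  rw [h₄.eqOff.reg _ (by simp), hE₃.reg _ (by simp), h₂.eqOff.reg _ (by simp), hhead]

/-- Link the trees with the distinct roots `rRoot` and `rNode` and move the half-edges at the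
former root. -/
def mergeRoots (K : ℕ) : Prog :=
  linkRoots ;; .copy rSrc rNode ;; moveHalfEdges K

theorem run_mergeRoots (hH : ∀ a k b, H a k b → k < K)
    (F : Forest V (m.fld fPar) (m.fld fRank) rt) (hu : m.reg rRoot < V) (hw : m.reg rNode < V)
    (hne : m.reg rRoot ≠ m.reg rNode) (hpu : m.fld fPar (m.reg rRoot) = m.reg rRoot)
    (hpw : m.fld fPar (m.reg rNode) = m.reg rNode) (hs : foldSetoid H (m.reg rRoot) (m.reg rNode))
    (h : ∀ u w, s(u, w) = s(m.reg rRoot, m.reg rNode) →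
      m.HasTables V K H (fun x => if rt x = u then w else rt x) (halfEdgesAtRoots H rt)) :
    Run (mergeRoots K) m fun t m' =>
      (∃ rt', m'.Stage V K H rt') ∧ m'.reg rHead = m.reg rHead ∧
      m'.reg rTail ≤ m.reg rTail + K ∧
      charge V (m.fld fPar) (m.fld fRank) ≤ charge V (m'.fld fPar) (m'.fld fRank) ∧
      numRoots V (m'.fld fPar) < numRoots V (m.fld fPar) ∧ t ≤ 7 * K + 10 := by
  rw [mergeRoots, run_seq]
  refine (run_linkRoots F hu hw hne hpu hpw).mono ?_
  rintro t₁ m₁ ⟨huw, F₁, hch, hnum, hE₁, ht₁⟩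
  have hlink : m₁.reg rRoot < V ∧ m₁.reg rNode < V ∧ m₁.reg rRoot ≠ m₁.reg rNode ∧
      foldSetoid H (m₁.reg rRoot) (m₁.reg rNode) := by
    rcases Sym2.eq_iff.1 huw with ⟨h₁, h₂⟩ | ⟨h₁, h₂⟩ <;> rw [h₁, h₂]
    exacts [⟨hu, hw, hne, hs⟩, ⟨hw, hu, hne.symm, Setoid.symm' _ hs⟩]
  obtain ⟨huV, hwV, hne', hs'⟩ := hlink
  have h₁ := (h _ _ huw).of_eqOff hE₁
  rw [run_seq, run_prim, Prim.run]
  generalize hm₂ : ({ m₁ with reg := _ } : Mem) = m₂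
  have hE₂ : m₁.EqOff {rSrc} ∅ m₂ := by
    subst hm₂
    constructor <;> simp +contextual
  have hsrc : m₂.reg rSrc = m₁.reg rNode := by simp [← hm₂]
  refine (run_moveHalfEdges (hE₂.reg _ (by simp)) hsrc (h₁.of_eqOff hE₂) huV hwV hne' hs').mono ?_
  rintro t₃ m₃ ⟨h₃, htail, hE₃, ht₃⟩
  have hE := hE₂.trans hE₃
  rw [← hE.fld fPar (by simp), ← hE.fld fRank (by simp)] at F₁ hch
  rw [← hE.fld fPar (by simp)] at hnum
  rw [hE₂.reg rTail (by simp), hE₁.reg rTail (by simp)] at htail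
  refine ⟨⟨_, F₁, h₃.verts, halfEdgesAtRoots_of_moved h₃.tables hH fun _ => rfl⟩, ?_, htail, hch,
    hnum, by omega⟩
  rw [hE.reg _ (by simp), hE₁.reg _ (by simp)]

/-- Take the first pair from the queue and identify its members. -/
def processPair (K : ℕ) : Prog :=
  findPairRoots ;; .ite (.eq rRoot rNode) (.prim .skip) (mergeRoots K)

/-- Process the queue until it is empty. -/
def processQueue (K : ℕ) : Prog :=
  .loop (.lt rHead rTail) (processPair K)

theorem run_processPair (h : m.Stage V K H rt) (hH : ∀ a k b, H a k b → k < K)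
    (hlt : m.reg rHead < m.reg rTail) :
    Run (processPair K) m fun t m' =>
      (∃ rt', m'.Stage V K H rt') ∧ m'.reg rHead = m.reg rHead + 1 ∧
      m'.reg rTail + K * numRoots V (m'.fld fPar) ≤
        m.reg rTail + K * numRoots V (m.fld fPar) ∧
      t + 5 * charge V (m.fld fPar) (m.fld fRank) ≤
        5 * charge V (m'.fld fPar) (m'.fld fRank) + 10 * logStar V + (7 * K + 30) := by
  have hT := h.hasTables.tables
  obtain ⟨ha, hb⟩ := hT.q_lt _ hlt
  rw [processPair, run_seq]
  refine (run_findPairRoots h.forest ha hb).mono ?_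
  rintro t₁ m₁ ⟨hroot, hnode, hhead, F, hnum, hE, ht₁⟩
  have htail : m₁.reg rTail = m.reg rTail := hE.reg _ (by simp)
  have hverts : m₁.reg rVerts = V := (hE.reg _ (by simp)).trans h.hasTables.verts
  have htables (rt' : ℕ → ℕ) (h' : Tables V K H rt' (halfEdgesAtRoots H rt)
      (fun k => m.fld (k + fTable)) (m.fld fFst) (m.fld fSnd) (m.reg rHead + 1) (m.reg rTail)) :
      m₁.HasTables V K H rt' (halfEdgesAtRoots H rt) := by
    refine ⟨hverts, ?_⟩
    simpa only [htail, hhead, hE.fld fFst (by simp), hE.fld fSnd (by simp),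
      fun k => hE.fld (k + fTable) (by simp)] using h'
  simp only [run_ite, Test.Holds, run_prim, Prim.run]
  constructor
  · intro heq
    refine ⟨⟨rt, F, htables rt (hT.pop hlt F.rt_lt (fun v hv => F.rt_rt hv) ?_ hT.rt_sound)⟩,
      hhead, by rw [htail, hnum], by omega⟩
    rw [← hroot, ← hnode, heq]
  · intro hne
    refine (run_mergeRoots hH F (hroot ▸ F.rt_lt _ ha) (hnode ▸ F.rt_lt _ hb) hne
      (hroot ▸ F.par_rt _ ha) (hnode ▸ F.par_rt _ hb)
      (hroot ▸ hnode ▸ hT.foldSetoid_of_pair hlt) fun u w huw => htables _ ?_).mono ?_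
    · exact hT.pop_link F hlt (hroot ▸ hnode ▸ huw)
    · rintro t m' ⟨hS, hhead', htail', hch, hnum', ht⟩
      have := Nat.mul_le_mul_left K (Nat.succ_le_of_lt hnum')
      rw [Nat.mul_succ, hnum] at this
      exact ⟨hS, hhead'.trans hhead, by omega, by omega⟩

theorem run_processQueue {Q : ℕ} (h : m.Stage V K H rt) (hH : ∀ a k b, H a k b → k < K)
    (hQ : m.reg rTail ≤ m.reg rHead + Q) :
    Run (processQueue K) m fun t m' =>
      (∃ rt', m'.Stage V K H rt') ∧ m'.reg rHead = m'.reg rTail ∧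
      t ≤ 5 * charge V (m'.fld fPar) (m'.fld fRank) +
        (Q + K * V) * (10 * logStar V + (7 * K + 31)) + 1 := by
  set D := 10 * logStar V + (7 * K + 31)
  refine (run_loop (fun k τ m₁ => (∃ rt', m₁.Stage V K H rt') ∧
    m₁.reg rTail + K * numRoots V (m₁.fld fPar) = m₁.reg rHead + k ∧
    τ + k * D ≤ 5 * charge V (m₁.fld fPar) (m₁.fld fRank) + (Q + K * V) * D)
    ?_ (τ := 0) (k := m.reg rTail + K * numRoots V (m.fld fPar) - m.reg rHead) ?_).mono ?_
  · rintro k τ m₁ ⟨⟨rt₁, h₁⟩, hk, hτ⟩ hlt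
    refine (run_processPair h₁ hH hlt).mono ?_
    rintro t m₂ ⟨⟨rt₂, h₂⟩, hhead, htail, ht⟩
    have hle := h₂.hasTables.tables.hd_le
    refine ⟨m₂.reg rTail + K * numRoots V (m₂.fld fPar) - m₂.reg rHead, by omega, ⟨_, h₂⟩,
      by omega, ?_⟩
    have hk' : m₂.reg rTail + K * numRoots V (m₂.fld fPar) - m₂.reg rHead + 1 ≤ k := by omega
    have := Nat.mul_le_mul_right D hk'
    rw [add_mul] at this
    omega
  · have hle := h.hasTables.tables.hd_le
    have hroots := Nat.mul_le_mul_left K (numRoots_le V (m.fld fPar))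
    have hk : m.reg rTail + K * numRoots V (m.fld fPar) - m.reg rHead ≤ Q + K * V := by omega
    have := Nat.mul_le_mul_right D hk
    exact ⟨⟨_, h⟩, by omega, by omega⟩
  · rintro t m' ⟨k, τ, ⟨⟨rt', h'⟩, hk, hτ⟩, (hb : ¬m'.reg rHead < m'.reg rTail), ht⟩
    have := h'.hasTables.tables.hd_le
    exact ⟨⟨_, h'⟩, by omega, by omega⟩

end

/-! ### Writing the folded graph -/

section

variable {V n : ℕ} {rt : ℕ → ℕ} {m : Mem}

theorem bijOn_update {α β : Type*} [DecidableEq α] {f : α → β} {s : Set α} {t : Set β} {a : α}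
    {b : β} (h : Set.BijOn f s t) (ha : a ∉ s) (hb : b ∉ t) :
    Set.BijOn (update f a b) (insert a s) (insert b t) := by
  have hf : Set.EqOn f (update f a b) s := fun x hx =>
    (update_of_ne (ne_of_mem_of_not_mem hx ha) _ _).symm
  have := (h.congr hf).insert (a := a) (by rwa [update_self])
  rwa [update_self] at this

/-- The roots among `0, …, V - 1` of the forest with parent pointers `par`. -/
def roots (V : ℕ) (par : ℕ → ℕ) : Set ℕ := {x | x < V ∧ par x = x}

theorem roots_succ_of_eq {par : ℕ → ℕ} (h : par V = V) :
    roots (V + 1) par = insert V (roots V par) := by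
  ext x
  simp only [roots, Set.mem_insert_iff, Set.mem_ofPred_eq]
  grind

theorem roots_succ_of_ne {par : ℕ → ℕ} (h : par V ≠ V) : roots (V + 1) par = roots V par := by
  ext x
  simp only [roots, Set.mem_ofPred_eq]
  grind

/-- Number the roots in increasing order. Their number is left in `rRoots`. -/
def numberRoots : Prog :=
  .const rRoots 0 ;; forLoop rIdx rVerts (.load rPar fPar rIdx ;;
    .ite (.eq rPar rIdx) (.store fNum rIdx rRoots ;; .succ rRoots) (.prim .skip))

theorem run_numberRoots (m : Mem) :
    Run numberRoots m fun t m' =>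
      m.EqOff {rIdx, rPar, rRoots} {fNum} m' ∧
      Set.BijOn (m'.fld fNum) (roots (m.reg rVerts) (m.fld fPar))
        (Set.Iio (m'.reg rRoots)) ∧ t ≤ 6 * m.reg rVerts + 3 := by
  rw [numberRoots, run_seq, run_prim, Prim.run]
  generalize hm₁ : ({ m with reg := _ } : Mem) = m₁
  have hE₁ : m.EqOff {rRoots} ∅ m₁ := by
    subst hm₁
    constructor <;> simp +contextual
  refine (run_forLoop (R := {rPar, rRoots}) (F := {fNum}) (fun j τ m' =>
    Set.BijOn (m'.fld fNum) (roots j (m.fld fPar)) (Set.Iio (m'.reg rRoots)) ∧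
      τ ≤ 6 * j) ?_ ?_).mono ?_
  · rintro j - τ m₂ hE₂ hj ⟨hB, hτ⟩
    have hpar : m₂.fld fPar = m.fld fPar := (hE₁.trans hE₂).fld _ (by simp)
    simp +decide only [run_seq, run_ite, run_prim, Prim.run, Test.Holds, update_self,
      update_of_ne, ne_eq, hj, hpar]
    refine ⟨fun hroot => ⟨?_, ?_, by omega⟩, fun hroot => ⟨?_, ?_, by omega⟩⟩
    · constructor <;> simp +contextual
    · rw [roots_succ_of_eq hroot, ← Order.succ_eq_add_one, Order.Iio_succ_eq_insert]
      exact bijOn_update hB (by simp [roots]) (by simp)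
    · constructor <;> simp +contextual
    · rwa [roots_succ_of_ne hroot]
  · simp [← hm₁, roots]
  · rintro t m' ⟨hE, τ, ⟨hB, hτ⟩, rfl⟩
    rw [hE₁.reg rVerts (by simp)] at hB hτ
    exact ⟨(hE₁.trans hE).mono, hB, by omega⟩

/-- Map each vertex to the number of its root. -/
def writeMap : Prog :=
  forLoop rIdx rVerts (.copy rNode rIdx ;; findRoot ;; .load rPar fNum rNode ;;
    .store fMap rIdx rPar)

theorem run_writeMap (hV : m.reg rVerts = V) (F : Forest V (m.fld fPar) (m.fld fRank) rt) :
    Run writeMap m fun t m' =>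
      m.EqOff {rIdx, rNode, rPar} {fMap, fPar} m' ∧
      Forest V (m'.fld fPar) (m'.fld fRank) rt ∧
      (∀ v < V, m'.fld fMap v = m.fld fNum (rt v)) ∧
      t + 5 * charge V (m.fld fPar) (m.fld fRank) ≤
        5 * charge V (m'.fld fPar) (m'.fld fRank) + V * (5 * logStar V + 12) + 2 := by
  rw [writeMap]
  refine (run_forLoop (R := {rNode, rPar}) (F := {fMap, fPar}) (fun j τ m' =>
    Forest V (m'.fld fPar) (m'.fld fRank) rt ∧
    (∀ v < j, m'.fld fMap v = m.fld fNum (rt v)) ∧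
    τ + 5 * charge V (m.fld fPar) (m.fld fRank) ≤
      5 * charge V (m'.fld fPar) (m'.fld fRank) + j * (5 * logStar V + 12)) ?_ ?_).mono ?_
  · rintro j hj τ m₁ hE₁ hidx ⟨F₁, hmap, hτ⟩
    rw [run_seq, run_prim, Prim.run, hidx]
    generalize hm₂ : ({ m₁ with reg := _ } : Mem) = m₂
    have hE₂ : m₁.EqOff {rNode} ∅ m₂ := by
      subst hm₂
      constructor <;> simp +contextual
    have hnode : m₂.reg rNode = j := by simp [← hm₂]
    rw [← hE₂.fld fPar (by simp), ← hE₂.fld fRank (by simp)] at F₁ hτ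
    rw [run_seq]
    refine (run_findRoot F₁ (by omega)).mono ?_
    rintro t₃ m₃ ⟨h₃, hroot, ht₃⟩
    have hE₃ := hE₂.trans h₃.eqOff
    have hnum : m₃.fld fNum = m.fld fNum := (hE₁.trans hE₃).fld _ (by simp)
    have hmap₃ : m₃.fld fMap = m₁.fld fMap := hE₃.fld _ (by simp)
    have hidx₃ : m₃.reg rIdx = j := (hE₃.reg _ (by simp)).trans hidx
    rw [hnode] at hroot
    simp +decide only [run_seq, run_prim, Prim.run, update_self, update_of_ne, ne_eq, hidx₃, hroot,
      hnum, hmap₃]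
    refine ⟨(hE₃.trans (m'' := _) (R' := {rPar}) (F' := {fMap}) ?_).mono, h₃.forest, ?_, ?_⟩
    · constructor <;> simp +contextual
    · intro v hv
      rcases Nat.lt_succ_iff_lt_or_eq.1 hv with hv | rfl
      · rw [update_of_ne hv.ne, hmap v hv]
      · rw [update_self]
    · rw [add_mul]
      omega
  · simpa using F
  · rintro t m' ⟨hE, τ, ⟨F', hmap, hτ⟩, rfl⟩
    rw [hV] at hmap hτ
    exact ⟨hE.mono, F', hmap, by omega⟩

/-- The source, the label, and the target of the edge `i` of the graph in memory. -/
def Mem.edgeTriple (m : Mem) (i : ℕ) : ℕ × ℕ × ℕ := (m.fld fIni i, m.fld fLab i, m.fld fTer i)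

/-- The edges of the folded graph with labels less than `n` that start at the root `x`, as found in
the tables. -/
def Mem.rowEdges (m : Mem) (x n : ℕ) : Set (ℕ × ℕ × ℕ) :=
  {e | ∃ k < n, m.fld (k + fTable) x ≠ m.reg rVerts ∧
    e = (m.fld fNum x, k, m.fld fMap (m.fld (k + fTable) x))}

theorem Mem.rowEdges_succ (m : Mem) (x k : ℕ) :
    m.rowEdges x (k + 1) = if m.fld (k + fTable) x = m.reg rVerts then m.rowEdges x k
      else insert (m.fld fNum x, k, m.fld fMap (m.fld (k + fTable) x)) (m.rowEdges x k) := by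
  ext e
  simp only [rowEdges, Nat.lt_succ_iff_lt_or_eq, or_and_right, exists_or, exists_eq_left]
  split_ifs with h
  · simp [h]
  · simp only [h, Set.mem_ofPred_eq, Set.mem_insert_iff, ne_eq, not_false_eq_true, true_and]
    exact or_comm

theorem Mem.EqOff.rowEdges_eq {R F : Set ℕ} {m' : Mem} (h : m.EqOff R F m') (x n : ℕ)
    (hR : rVerts ∉ R := by simp) (hMap : fMap ∉ F := by simp) (hNum : fNum ∉ F := by simp)
    (hT : ∀ k, k + fTable ∉ F := by simp) : m'.rowEdges x n = m.rowEdges x n := by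
  simp only [rowEdges, h.reg _ hR, h.fld _ hMap, h.fld _ hNum, h.fld _ (hT _)]

/-- Write the edge with label `k` that starts at the root `rIdx`, if there is one. -/
def writeEdge (k : ℕ) : Prog :=
  .load rTgt (k + fTable) rIdx ;; .ite (.eq rTgt rVerts) (.prim .skip)
    (.load rTmp fNum rIdx ;; .store fIni rOut rTmp ;;
      .load rTmp fMap rTgt ;; .store fTer rOut rTmp ;;
      .const rTmp k ;; .store fLab rOut rTmp ;; .succ rOut)

/-- Write the edges that start at `rIdx`, if this is a root. -/
def writeRow (n : ℕ) : Prog :=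
  .load rPar fPar rIdx ;; .ite (.eq rPar rIdx) (unroll writeEdge n) (.prim .skip)

/-- Write, root by root, the edges of the folded graph. Their number is left in `rOut`. -/
def writeEdges (n : ℕ) : Prog :=
  .const rOut 0 ;; forLoop rIdx rVerts (writeRow n)

theorem run_writeEdge {k : ℕ} {S : Set (ℕ × ℕ × ℕ)}
    (h : Set.BijOn m.edgeTriple (Set.Iio (m.reg rOut)) (S ∪ m.rowEdges (m.reg rIdx) k))
    (hS : ∀ e ∈ S, e.1 ≠ m.fld fNum (m.reg rIdx)) :
    Run (writeEdge k) m fun t m' =>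
      m.EqOff {rTgt, rTmp, rOut} {fIni, fTer, fLab} m' ∧
      Set.BijOn m'.edgeTriple (Set.Iio (m'.reg rOut))
        (S ∪ m.rowEdges (m.reg rIdx) (k + 1)) ∧ t ≤ 9 := by
  rw [m.rowEdges_succ]
  simp +decide only [writeEdge, run_seq, run_ite, run_prim, Prim.run, Test.Holds, update_self,
    update_of_ne, ne_eq]
  generalize m.reg rIdx = x at *
  refine ⟨fun hV => ⟨?_, by rwa [if_pos hV], by simp⟩, fun hV => ⟨?_, ?_, by simp⟩⟩
  · constructor <;> simp +contextual
  · constructor <;> simp +contextual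
  · have hnew : (m.fld fNum x, k, m.fld fMap (m.fld (k + fTable) x)) ∉ S ∪ m.rowEdges x k := by
      rintro (he | ⟨j, hj, -, he⟩)
      · exact hS _ he rfl
      · simp only [Prod.mk.injEq] at he
        omega
    rw [if_neg hV, Set.union_insert, ← Order.succ_eq_add_one, Order.Iio_succ_eq_insert]
    convert bijOn_update h (a := m.reg rOut) (by simp) hnew using 1
    ext i : 1
    rcases eq_or_ne i (m.reg rOut) with rfl | hi
    · simp [Mem.edgeTriple]
    · simp [Mem.edgeTriple, hi]

theorem run_unroll_writeEdge {S : Set (ℕ × ℕ × ℕ)}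
    (h : Set.BijOn m.edgeTriple (Set.Iio (m.reg rOut)) S)
    (hS : ∀ e ∈ S, e.1 ≠ m.fld fNum (m.reg rIdx)) :
    Run (unroll writeEdge n) m fun t m' =>
      m.EqOff {rTgt, rTmp, rOut} {fIni, fTer, fLab} m' ∧
      Set.BijOn m'.edgeTriple (Set.Iio (m'.reg rOut)) (S ∪ m.rowEdges (m.reg rIdx) n) ∧
      t ≤ 9 * n + 1 := by
  refine (run_unroll (R := {rTgt, rTmp, rOut}) (F := {fIni, fTer, fLab}) (fun k τ m' =>
    Set.BijOn m'.edgeTriple (Set.Iio (m'.reg rOut)) (S ∪ m.rowEdges (m.reg rIdx) k) ∧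
      τ ≤ 9 * k) ?_ ?_).mono ?_
  · rintro k - τ m₁ hE ⟨h₁, hτ⟩
    rw [← hE.reg rIdx (by simp), ← hE.rowEdges_eq] at h₁
    rw [← hE.reg rIdx (by simp), ← hE.fld fNum (by simp)] at hS
    refine (run_writeEdge h₁ hS).mono ?_
    rintro t m' ⟨hE', h', ht⟩
    rw [hE.reg rIdx (by simp), hE.rowEdges_eq] at h'
    exact ⟨hE', h', by omega⟩
  · simpa [Mem.rowEdges] using h
  · rintro t m' ⟨hE, τ, ⟨h', hτ⟩, rfl⟩
    exact ⟨hE, h', by omega⟩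

theorem run_writeRow (hlt : m.reg rIdx < V)
    (hN : Set.InjOn (m.fld fNum) (roots V (m.fld fPar)))
    (h : Set.BijOn m.edgeTriple (Set.Iio (m.reg rOut))
      (⋃ x ∈ roots (m.reg rIdx) (m.fld fPar), m.rowEdges x n)) :
    Run (writeRow n) m fun t m' =>
      m.EqOff {rPar, rTgt, rTmp, rOut} {fIni, fTer, fLab} m' ∧
      Set.BijOn m'.edgeTriple (Set.Iio (m'.reg rOut))
        (⋃ x ∈ roots (m.reg rIdx + 1) (m.fld fPar), m.rowEdges x n) ∧ t ≤ 9 * n + 3 := by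
  rw [writeRow, run_seq, run_prim, Prim.run]
  generalize hm₁ : ({ m with reg := _ } : Mem) = m₁
  have hE : m.EqOff {rPar} ∅ m₁ := by
    subst hm₁
    constructor <;> simp +contextual
  have hidx : m₁.reg rIdx = m.reg rIdx := hE.reg _ (by simp)
  have hpar : m₁.reg rPar = m.fld fPar (m.reg rIdx) := by simp [← hm₁]
  have h₁ : Set.BijOn m₁.edgeTriple (Set.Iio (m₁.reg rOut))
      (⋃ x ∈ roots (m.reg rIdx) (m.fld fPar), m.rowEdges x n) := by
    rw [hE.reg rOut (by simp)]
    rwa [← hm₁]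
  simp only [run_ite, run_prim, Prim.run, Test.Holds, hidx, hpar]
  refine ⟨fun hroot => ?_, fun hroot => ⟨hE.mono, by rwa [roots_succ_of_ne hroot], by omega⟩⟩
  have hnew : ∀ e ∈ ⋃ x ∈ roots (m.reg rIdx) (m.fld fPar), m.rowEdges x n,
      e.1 ≠ m₁.fld fNum (m₁.reg rIdx) := by
    rw [hidx, hE.fld fNum (by simp)]
    simp only [Set.mem_iUnion]
    rintro _ ⟨x, ⟨hx, hpx⟩, k, -, -, rfl⟩ heq
    exact hx.ne (hN ⟨hx.trans hlt, hpx⟩ ⟨hlt, hroot⟩ heq)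
  refine (run_unroll_writeEdge h₁ hnew).mono ?_
  rintro t m' ⟨hE', h', ht⟩
  rw [hidx, hE.rowEdges_eq] at h'
  refine ⟨(hE.trans hE').mono, ?_, by omega⟩
  rwa [roots_succ_of_eq hroot, Set.biUnion_insert, Set.union_comm]

theorem run_writeEdges
    (hN : Set.InjOn (m.fld fNum) (roots (m.reg rVerts) (m.fld fPar))) :
    Run (writeEdges n) m fun t m' =>
      m.EqOff {rIdx, rPar, rTgt, rTmp, rOut} {fIni, fTer, fLab} m' ∧
      Set.BijOn m'.edgeTriple (Set.Iio (m'.reg rOut))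
        (⋃ x ∈ roots (m.reg rVerts) (m.fld fPar), m.rowEdges x n) ∧
      t ≤ (9 * n + 6) * m.reg rVerts + 3 := by
  rw [writeEdges, run_seq, run_prim, Prim.run]
  generalize hm₁ : ({ m with reg := _ } : Mem) = m₁
  have hE₁ : m.EqOff {rOut} ∅ m₁ := by
    subst hm₁
    constructor <;> simp +contextual
  refine (run_forLoop (R := {rPar, rTgt, rTmp, rOut}) (F := {fIni, fTer, fLab}) (fun j τ m' =>
    Set.BijOn m'.edgeTriple (Set.Iio (m'.reg rOut))
      (⋃ x ∈ roots j (m.fld fPar), m.rowEdges x n) ∧ τ ≤ (9 * n + 6) * j)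
    ?_ ?_).mono ?_
  · rintro j hj τ m₂ hE₂ rfl ⟨h₂, hτ⟩
    rw [hE₁.reg rVerts (by simp)] at hj
    have hE := hE₁.trans hE₂
    simp only [← hE.fld fPar (by simp), ← hE.rowEdges_eq _ n] at h₂
    rw [← hE.fld fPar (by simp), ← hE.fld fNum (by simp)] at hN
    refine (run_writeRow hj hN h₂).mono ?_
    rintro t m' ⟨hE', h', ht⟩
    simp only [hE.fld fPar (by simp), hE.rowEdges_eq] at h'
    refine ⟨hE', h', ?_⟩
    rw [mul_add]
    omega
  · simp [← hm₁, roots]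
  · rintro t m' ⟨hE, τ, ⟨hB, hτ⟩, rfl⟩
    rw [hE₁.reg rVerts (by simp)] at hB hτ
    exact ⟨(hE₁.trans hE).mono, hB, by omega⟩

end

/-! ### The folding algorithm -/

section

variable {V n E : ℕ} {H : ℕ → ℕ → ℕ → Prop} {ini ter lab par rk rt : ℕ → ℕ} {m : Mem}

theorem Forest.rt_mem_roots (F : Forest V par rk rt) {v : ℕ} (hv : v < V) :
    rt v ∈ roots V par :=
  ⟨F.rt_lt v hv, F.par_rt v hv⟩

theorem Forest.image_rt (F : Forest V par rk rt) : rt '' Set.Iio V = roots V par := by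
  have hsub : rt '' Set.Iio V ⊆ roots V par := by
    rintro _ ⟨v, hv, rfl⟩
    exact F.rt_mem_roots hv
  exact hsub.antisymm fun x hx => ⟨x, hx.1, F.rt_self x hx.1 hx.2⟩

namespace Mem.Stage

variable {K : ℕ}

theorem table_of_halfEdge (h : m.Stage V K H rt) (hq : m.reg rHead = m.reg rTail) {a k b : ℕ}
    (hab : H a k b) : m.fld (k + fTable) (rt a) ≠ V ∧ rt (m.fld (k + fTable) (rt a)) = rt b := by
  refine (h.hasTables.tables.complete _ k b ⟨a, hab, rfl⟩).imp_right fun hb => ?_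
  exact pendingSetoid_le (r := Setoid.ker rt) (fun v hv => h.forest.rt_rt hv) (by omega) hb

theorem rt_eq_rt_iff (h : m.Stage V K H rt) (hq : m.reg rHead = m.reg rTail) {u v : ℕ}
    (hu : u < V) (hv : v < V) : rt u = rt v ↔ foldSetoid H u v := by
  constructor
  · intro huv
    have := h.hasTables.tables.rt_sound u hu
    rw [huv] at this
    exact Setoid.trans' _ (Setoid.symm' _ this) (h.hasTables.tables.rt_sound v hv)
  · refine fun huv => foldSetoid_le (r := Setoid.ker rt) ?_ huv
    intro a b a' b' k hb hb' (haa' : rt a = rt a')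
    rw [Setoid.ker_def, ← (h.table_of_halfEdge hq hb).2, haa', (h.table_of_halfEdge hq hb').2]

theorem biUnion_rowEdges (h : m.Stage V (2 * n) (halfEdge n ini ter lab E) rt)
    (hq : m.reg rHead = m.reg rTail) (hini : ∀ e < E, ini e < V) (hter : ∀ e < E, ter e < V)
    (hlab : ∀ e < E, lab e < n) (hmap : ∀ v < V, m.fld fMap v = m.fld fNum (rt v)) :
    ⋃ x ∈ roots V (m.fld fPar), m.rowEdges x n =
      (fun e => (m.fld fMap (ini e), lab e, m.fld fMap (ter e))) '' Set.Iio E := by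
  have hT {k x : ℕ} (hk : k < n) (hx : x < V) (hne : m.fld (k + fTable) x ≠ V) :
      m.fld (k + fTable) x < V :=
    (h.hasTables.tables.T_le k (by omega) x hx).lt_of_ne hne
  have hmap_eq {u v : ℕ} (hu : u < V) (hv : v < V) (huv : rt u = rt v) :
      m.fld fMap u = m.fld fMap v := by
    rw [hmap u hu, hmap v hv, huv]
  ext p
  simp only [Set.mem_iUnion, Mem.rowEdges, h.hasTables.verts, Set.mem_image, Set.mem_Iio]
  constructor
  · rintro ⟨x, hx, k, hk, hne, rfl⟩
    obtain ⟨a, b, ⟨e, he, ⟨rfl, rfl, rfl⟩ | ⟨-, rfl, -⟩⟩, ha, hb⟩ :=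
      h.hasTables.tables.T_sound k (by omega) x hx.1 hne
    · rw [← h.rt_eq_rt_iff hq (hini e he) hx.1] at ha
      rw [← h.rt_eq_rt_iff hq (hter e he) (hT hk hx.1 hne)] at hb
      refine ⟨e, he, ?_⟩
      rw [hmap _ (hini e he), ha, h.forest.rt_self x hx.1 hx.2,
        hmap_eq (hter e he) (hT hk hx.1 hne) hb]
    · omega
  · rintro ⟨e, he, rfl⟩
    have hx := h.forest.rt_mem_roots (hini e he)
    obtain ⟨hne, hb⟩ := h.table_of_halfEdge hq ⟨e, he, .inl ⟨rfl, rfl, rfl⟩⟩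
    refine ⟨_, hx, lab e, hlab e he, hne, ?_⟩
    rw [hmap _ (hini e he), hmap_eq (hter e he) (hT (hlab e he) hx.1 hne) hb.symm]

end Mem.Stage

/-- The memory holds the quotient by `r` of the graph with vertices `0, …, V - 1` and edges
`0, …, E - 1`, with parallel edges of the same label merged, and the quotient map. -/
structure Mem.HoldsQuotient (m : Mem) (r : Setoid ℕ) (ini ter lab : ℕ → ℕ) (V E : ℕ) : Prop where
  image_map : m.fld fMap '' Set.Iio V = Set.Iio (m.reg rVerts)
  map_eq_map_iff : ∀ u < V, ∀ v < V, m.fld fMap u = m.fld fMap v ↔ r u v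
  bijOn_edges : Set.BijOn m.edgeTriple (Set.Iio (m.reg rEdges))
    ((fun e => (m.fld fMap (ini e), lab e, m.fld fMap (ter e))) '' Set.Iio E)

/-- Write the folded graph and the quotient map, once the queue is empty. -/
def writeQuotient (n : ℕ) : Prog :=
  numberRoots ;; writeMap ;; writeEdges n ;; .copy rVerts rRoots ;; .copy rEdges rOut

theorem run_writeQuotient (h : m.Stage V (2 * n) (halfEdge n ini ter lab E) rt)
    (hq : m.reg rHead = m.reg rTail) (hini : ∀ e < E, ini e < V) (hter : ∀ e < E, ter e < V)
    (hlab : ∀ e < E, lab e < n) :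
    Run (writeQuotient n) m fun t m' =>
      m'.HoldsQuotient (foldSetoid (halfEdge n ini ter lab E)) ini ter lab V E ∧
      t + 5 * charge V (m.fld fPar) (m.fld fRank) ≤
        5 * (2 * V * (logStar V + 1)) + V * (5 * logStar V + (9 * n + 24)) + 10 := by
  simp only [writeQuotient, run_seq]
  refine (run_numberRoots m).mono ?_
  rintro t₁ m₁ ⟨hE₁, hN, ht₁⟩
  have F₁ : Forest V (m₁.fld fPar) (m₁.fld fRank) rt := by
    rw [hE₁.fld _ (by simp), hE₁.fld _ (by simp)]
    exact h.forest
  refine (run_writeMap ((hE₁.reg _ (by simp)).trans h.hasTables.verts) F₁).mono ?_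
  rintro t₂ m₂ ⟨hE₂, F₂, hmap, ht₂⟩
  have h₂ : m₂.Stage V (2 * n) (halfEdge n ini ter lab E) rt :=
    ⟨F₂, (h.hasTables.of_eqOff hE₁).of_eqOff hE₂⟩
  have hq₂ : m₂.reg rHead = m₂.reg rTail := by
    rwa [(hE₁.trans hE₂).reg _ (by simp), (hE₁.trans hE₂).reg _ (by simp)]
  rw [← hE₂.fld fNum (by simp)] at hmap hN
  rw [h.hasTables.verts, ← h.forest.image_rt, F₂.image_rt] at hN
  refine (run_writeEdges (h₂.hasTables.verts ▸ hN.injOn)).mono ?_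
  rintro t₃ m₃ ⟨hE₃, hB, ht₃⟩
  rw [h₂.hasTables.verts] at hB ht₃
  rw [h₂.biUnion_rowEdges hq₂ hini hter hlab hmap, ← hE₃.fld fMap (by simp)] at hB
  rw [← hE₂.reg rRoots (by simp), ← hE₃.reg rRoots (by simp)] at hN
  rw [← hE₃.fld fMap (by simp)] at hmap
  simp +decide only [run_prim, Prim.run, update_of_ne, ne_eq]
  refine ⟨⟨?_, fun u hu v hv => ?_, hB⟩, ?_⟩
  · change m₃.fld fMap '' Set.Iio V = Set.Iio (m₃.reg rRoots)
    rw [Set.image_congr fun v (hv : v ∈ Set.Iio V) => hmap v hv, ← hN.image_eq, ← F₂.image_rt,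
      Set.image_image]
  · rw [← h₂.rt_eq_rt_iff hq₂ hu hv]
    simp only [hmap u hu, hmap v hv]
    exact hN.injOn.eq_iff (F₂.rt_mem_roots hu) (F₂.rt_mem_roots hv)
  · have hcharge := F₂.charge_le
    rw [hE₁.fld _ (by simp), hE₁.fld _ (by simp)] at ht₂
    rw [h.hasTables.verts] at ht₁
    ring_nf at *
    omega

/-- Fold the graph in memory, whose labels are less than `n`. -/
def foldGraph (n : ℕ) : Prog :=
  setUp (2 * n) ;; enterEdges n ;; processQueue (2 * n) ;; writeQuotient n

/-- The constant in the running time of `foldGraph n`. -/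
def foldGraphConst (n : ℕ) : ℕ := (2 * n + 2) * (14 * n + 31) + (11 * n + 39)

theorem foldGraph_time_le (n V E L : ℕ) :
    (2 * n + 5) * V + 5 + ((2 * n + 18) * E + 2) +
      ((2 * E + 2 * n * V) * (10 * L + (7 * (2 * n) + 31)) + 1) +
      (5 * (2 * V * (L + 1)) + V * (5 * L + (9 * n + 24)) + 10) ≤
    foldGraphConst n * ((V + E + 1) * (L + 1)) := by
  have hqueue : (2 * E + 2 * n * V) * (10 * L + (7 * (2 * n) + 31)) ≤
      (2 * n + 2) * (V + E + 1) * ((14 * n + 31) * (L + 1)) := by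
    gcongr <;> ring_nf <;> omega
  have hlinear : (2 * n + 5) * V + (2 * n + 18) * E + (10 * V * (L + 1)) +
      V * (5 * L + (9 * n + 24)) + 18 ≤ (11 * n + 39) * ((V + E + 1) * (L + 1)) := by
    ring_nf
    omega
  rw [foldGraphConst]
  ring_nf at *
  omega

theorem run_foldGraph (hini : ∀ e < E, m.fld fIni e < V) (hter : ∀ e < E, m.fld fTer e < V)
    (hlab : ∀ e < E, m.fld fLab e < n) (hV : m.reg rVerts = V) (hE : m.reg rEdges = E) :
    Run (foldGraph n) m fun t m' =>
      m'.HoldsQuotient (foldSetoid (halfEdge n (m.fld fIni) (m.fld fTer) (m.fld fLab) E))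
        (m.fld fIni) (m.fld fTer) (m.fld fLab) V E ∧
      t ≤ foldGraphConst n * ((V + E + 1) * (logStar V + 1)) := by
  simp only [foldGraph, run_seq]
  refine (run_setUp (2 * n) m).mono ?_
  rintro t₁ m₁ ⟨hE₁, hhead, htail, -, hfresh, ht₁⟩
  rw [hV] at hfresh ht₁
  rw [← hE₁.fld fIni (by simp), ← hE₁.fld fTer (by simp), ← hE₁.fld fLab (by simp)] at *
  refine (run_enterEdges hini hter hlab ((hE₁.reg _ (by simp)).trans hE) htail
    (m₁.hasTables_of_isFresh ((hE₁.reg _ (by simp)).trans hV) hhead htail hfresh)).mono ?_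
  rintro t₂ m₂ ⟨hT₂, htail₂, hE₂, ht₂⟩
  set H := halfEdge n (m₁.fld fIni) (m₁.fld fTer) (m₁.fld fLab) E
  have h₂ : m₂.Stage V (2 * n) H fun x => x := by
    refine ⟨.of_singletons ?_ ?_, hT₂.mono ?_⟩
    · rw [hE₂.fld _ (by simp)]
      exact fun v hv => (hfresh v hv).1
    · rw [hE₂.fld _ (by simp)]
      exact fun v hv => (hfresh v hv).2.1
    · rintro _ k b ⟨a, hab, rfl⟩
      exact hab
  have hH : ∀ a k b, H a k b → k < 2 * n := by
    rintro - - - ⟨e, he, ⟨-, rfl, -⟩ | ⟨-, rfl, -⟩⟩ <;> have := hlab e he <;> omega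
  refine (run_processQueue h₂ hH (htail₂.trans (Nat.le_add_left _ _))).mono ?_
  rintro t₃ m₃ ⟨⟨rt, h₃⟩, hq, ht₃⟩
  refine (run_writeQuotient h₃ hq hini hter hlab).mono ?_
  rintro t₄ m₄ ⟨h₄, ht₄⟩
  refine ⟨h₄, le_trans ?_ (foldGraph_time_le n V E (logStar V))⟩
  omega

end

/-! ### Numbered graphs -/

section

variable {n : ℕ} {G Γ : LGraph (Fin n)} {N : Numbering G} {m m' : Mem}

theorem range_equiv_fin {α : Type*} {s : ℕ} (φ : α ≃ Fin s) :
    Set.range (fun a => (φ a : ℕ)) = Set.Iio s :=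
  (φ.surjective.range_comp Fin.val).trans Fin.range_val

theorem Mem.Encodes.exists_edge (h : m.Encodes G N) {i : ℕ} (hi : i < N.numE) :
    ∃ e, m.fld fIni i = N.vert (G.ini e) ∧ m.fld fTer i = N.vert (G.ter e) ∧
      m.fld fLab i = G.lab e := by
  obtain ⟨e, rfl⟩ := (range_equiv_fin N.edge).ge hi
  exact ⟨e, h.2.2 e⟩

theorem Mem.Encodes.lt (h : m.Encodes G N) {i : ℕ} (hi : i < N.numE) :
    m.fld fIni i < N.numV ∧ m.fld fTer i < N.numV ∧ m.fld fLab i < n := by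
  obtain ⟨e, h₀, h₁, h₂⟩ := h.exists_edge hi
  rw [h₀, h₁, h₂]
  exact ⟨Fin.is_lt _, Fin.is_lt _, Fin.is_lt _⟩

/-- The number that stands for a type of half-edges in memory. -/
def halfEdgeType (n : ℕ) : Fin n ⊕ Fin n → ℕ := Sum.elim (fun x => x) fun x => x + n

theorem halfEdgeType_injective (n : ℕ) : Injective (halfEdgeType n) := by
  rintro (x | x) (y | y) h <;> simp only [halfEdgeType, Sum.elim_inl, Sum.elim_inr] at h
  · rw [Fin.ext h]
  · omega
  · omega
  · rw [Fin.ext (Nat.add_right_cancel h)]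

theorem Mem.Encodes.halfEdge_eq (h : m.Encodes G N) :
    halfEdge n (m.fld fIni) (m.fld fTer) (m.fld fLab) N.numE =
      mapHalfEdges G.HalfEdge (fun v => (N.vert v : ℕ)) (halfEdgeType n) := by
  ext a k b
  constructor
  · rintro ⟨i, hi, hab⟩
    obtain ⟨e, h₀, h₁, h₂⟩ := h.exists_edge hi
    rw [h₀, h₁, h₂] at hab
    obtain ⟨rfl, rfl, rfl⟩ | ⟨rfl, rfl, rfl⟩ := hab
    · exact ⟨_, .inl _, _, ⟨e, rfl, rfl, rfl⟩, rfl, rfl, rfl⟩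
    · exact ⟨_, .inr _, _, ⟨e, rfl, rfl, rfl⟩, rfl, rfl, rfl⟩
  · rintro ⟨_, x | x, _, ⟨e, rfl, rfl, rfl⟩, rfl, rfl, rfl⟩ <;> obtain ⟨h₀, h₁, h₂⟩ := h.2.2 e
    · exact ⟨N.edge e, (N.edge e).2, .inl ⟨h₀.symm, h₂.symm, h₁.symm⟩⟩
    · exact ⟨N.edge e, (N.edge e).2, .inr ⟨h₁.symm, by rw [h₂]; rfl, h₀.symm⟩⟩

theorem Mem.Encodes.foldSetoid_iff (h : m.Encodes G N) (u v : G.Vert) :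
    foldSetoid (halfEdge n (m.fld fIni) (m.fld fTer) (m.fld fLab) N.numE) (N.vert u) (N.vert v) ↔
      foldSetoid G.HalfEdge u v := by
  rw [h.halfEdge_eq, ← comap_foldSetoid_mapHalfEdges (H := G.HalfEdge)
    (Fin.val_injective.comp N.vert.injective) (halfEdgeType_injective n)]
  rfl

theorem exists_equiv_fin_of_bijOn {α β : Type*} {s : ℕ} {f : ℕ → β} {g : α → β}
    (hf : Set.BijOn f (Set.Iio s) (Set.range g)) (hg : Injective g) :
    ∃ ψ : α ≃ Fin s, ∀ a, f (ψ a) = g a := by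
  refine ⟨(Equiv.ofInjective g hg).trans ((hf.equiv f).symm.trans Fin.equivSubtype.symm),
    fun a => ?_⟩
  exact congr_arg Subtype.val ((hf.equiv f).apply_symm_apply (Equiv.ofInjective g hg a))

theorem exists_equiv_fin_of_ker_eq {α β : Type*} {s : ℕ} {p : α → β} {q : α → ℕ}
    (hp : Surjective p) (hq : Set.range q = Set.Iio s) (h : ∀ a b, q a = q b ↔ p a = p b) :
    ∃ φ : β ≃ Fin s, ∀ a, φ (p a) = q a := by
  have hlift : (q ∘ surjInv hp) ∘ p = q :=
    funext fun a => (h _ _).2 (surjInv_eq hp (p a))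
  have hinj : Injective (q ∘ surjInv hp) := fun b b' hb => by
    simpa only [surjInv_eq] using (h _ _).1 hb
  have hrange : Set.range (q ∘ surjInv hp) = Set.Iio s := by
    rw [← hq, ← hp.range_comp, hlift]
  obtain ⟨φ, hφ⟩ := exists_equiv_fin_of_bijOn (f := _root_.id)
    (by rw [hrange]; exact Set.bijOn_id _) hinj
  exact ⟨φ, fun a => (hφ (p a)).trans (congr_fun hlift a)⟩

theorem Mem.HoldsQuotient.exists_numbering {π : G.Hom Γ} (hπ : IsFolding π) (hΓ : Γ.Folded)
    (hm : m.Encodes G N)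
    (h : m'.HoldsQuotient
      (foldSetoid (halfEdge n (m.fld fIni) (m.fld fTer) (m.fld fLab) N.numE))
      (m.fld fIni) (m.fld fTer) (m.fld fLab) N.numV N.numE) :
    ∃ M : Numbering Γ, m'.Encodes Γ M ∧ m'.EncodesMap π N M := by
  obtain ⟨φ, hφ⟩ : ∃ φ : Γ.Vert ≃ Fin (m'.reg rVerts),
      ∀ v, (φ (π.vert v) : ℕ) = m'.fld fMap (N.vert v) := by
    refine exists_equiv_fin_of_ker_eq hπ.surjective_vert ?_ fun u v => ?_
    · rw [← h.image_map, ← range_equiv_fin N.vert, ← Set.range_comp]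
      rfl
    · rw [h.map_eq_map_iff _ (N.vert u).2 _ (N.vert v).2, hm.foldSetoid_iff,
        ← hπ.ker_vert_eq_foldSetoid hΓ, Setoid.ker_def]
  obtain ⟨ψ, hψ⟩ : ∃ ψ : Γ.Edge ≃ Fin (m'.reg rEdges),
      ∀ e, m'.edgeTriple (ψ e) = ((φ (Γ.ini e) : ℕ), (Γ.lab e : ℕ), (φ (Γ.ter e) : ℕ)) := by
    refine exists_equiv_fin_of_bijOn ?_ fun e e' he => ?_
    · convert h.bijOn_edges using 1
      rw [← range_equiv_fin N.edge, ← Set.range_comp, ← hπ.surjective_edge.range_comp]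
      congr 1
      ext e : 1
      obtain ⟨h₀, h₁, h₂⟩ := hm.2.2 e
      simp only [comp_apply, h₀, h₁, h₂, ← hφ, π.ini_edge, π.ter_edge, π.lab_edge]
    · simp only [Prod.mk.injEq, Fin.val_inj, φ.apply_eq_iff_eq] at he
      exact hΓ.1 e e' he.2.1 he.1
  refine ⟨⟨_, _, φ, ψ⟩, ⟨rfl, rfl, fun e => ?_⟩, fun v => (hφ v).symm⟩
  simpa only [Mem.edgeTriple, Prod.mk.injEq, and_comm, and_left_comm] using hψ e

end

end Stallings

theorem theorem2_general (n : ℕ) :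
    ∃ (P : Stallings.Prog) (C : ℕ),
      ∀ (Δ : Stallings.LGraph (Fin n)) (N : Stallings.Numbering Δ) (m : Stallings.Mem),
        m.Encodes Δ N →
          ∃ (t : ℕ) (m' : Stallings.Mem), Stallings.Exec P m t m' ∧
            t ≤ C * max 1 (N.numE + (N.numV + N.numE) * Stallings.logStar N.numV) ∧
            ∃ (Γ : Stallings.LGraph (Fin n)) (π : Δ.Hom Γ) (M : Stallings.Numbering Γ),
              Stallings.IsFolding π ∧ Γ.Folded ∧ m'.Encodes Γ M ∧ m'.EncodesMap π N M := by
  refine ⟨Stallings.foldGraph n, Stallings.foldGraphConst n * 4, fun Δ N m hm => ?_⟩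
  have : Finite Δ.Edge := .of_equiv _ N.edge.symm
  obtain ⟨Γ, π, hπ, hΓ⟩ := Δ.exists_isFolding
  obtain ⟨t, m', hexec, hquot, ht⟩ := Stallings.run_foldGraph (fun e he => (hm.lt he).1)
    (fun e he => (hm.lt he).2.1) (fun e he => (hm.lt he).2.2) hm.1 hm.2.1
  obtain ⟨M, hM, hπM⟩ := hquot.exists_numbering hπ hΓ hm
  refine ⟨t, m', hexec, ht.trans ?_, Γ, π, M, hπ, hΓ, hM, hπM⟩
  rw [mul_assoc]
  exact Nat.mul_le_mul_left _ (Stallings.mul_logStar_succ_le _ _)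

/-- For every finite alphabet there are a program and a constant `C` such that, on every connected
directed labeled graph `Δ` with `V` vertices and `E` edges, the program stops after time at most
`C (E + (V + E) log* V)` and leaves in memory a folded graph `Γ` obtained from `Δ` by a sequence of
elementary foldings, with the quotient map on vertices. The `max 1` matters only if `V = 1` and
`E = 0`, where the bound would be 0. -/
theorem theorem2 (n : ℕ) :
    ∃ (P : Stallings.Prog) (C : ℕ),
      ∀ (Δ : Stallings.LGraph (Fin n)) (N : Stallings.Numbering Δ), Δ.Connected →
        ∀ m : Stallings.Mem, m.Encodes Δ N →
          ∃ (t : ℕ) (m' : Stallings.Mem), Stallings.Exec P m t m' ∧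
            t ≤ C * max 1 (N.numE + (N.numV + N.numE) * Stallings.logStar N.numV) ∧
            ∃ (Γ : Stallings.LGraph (Fin n)) (π : Δ.Hom Γ) (M : Stallings.Numbering Γ),
              Stallings.IsFolding π ∧ Γ.Folded ∧ m'.Encodes Γ M ∧ m'.EncodesMap π N M := by
  obtain ⟨P, C, h⟩ := theorem2_general n
  exact ⟨P, C, fun Δ N _ => h Δ N⟩
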